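/- Conventions. An IQP circuit on $n$ qubits is a unitary $C=H^{\otimes n}C_ZH^{\otimes n}$, where $C_Z$ is a product of one- and two-qubit gates that are diagonal in the $Z$ basis; $n$ always denotes the number of qubits of $C$. A language $L\subseteq\{0,1\}^*$ is in $\mathsf{coC_=P}$ if there are a polynomial $p$ and a polynomial-time computable $f(x,y)\in\{-1,1\}$ such that, for all $x$, $x\in L \iff \sum_{y\in\{0,1\}^{p(|x|)}} f(x,y)\neq 0$. A computational problem is $\mathsf{coC_=P}$-hard if every $L\in\mathsf{coC_=P}$ reduces to it by a deterministic polynomial-time one-query reduction: there are polynomial-time computable maps $g,h$ such that, for every $x$, $g(x)$ is an instance of the problem and, for every valid solution $v$ of the instance $g(x)$, $x\in L\iff h(x,v)=1$. Theorem. There is a family $(\mathcal F_n)_{n\ge 0}$, where $\mathcal F_n$ is a set of IQP circuits on $n$ qubits, each with at most polynomially many (in $n$) gates, all taken from $S=\mathrm{diag}(1,i)$, $T=\mathrm{diag}(1,e^{i\pi/4})$ and $CZ=\mathrm{diag}(1,1,1,-1)$, with $\mathcal F_n\neq\emptyset$ for all sufficiently large $n$, such that the following problem is $\mathsf{coC_=P}$-hard: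 given (the number of qubits and the list of gates of) a circuit $C\in\bigcup_n\mathcal F_n$ on $n$ qubits, output a rational number $v$ with $$\bigl|\,v-|\langle 0^n|C|0^n\rangle|^2\,\bigr|\le \frac{1}{2^{2n+1}}.$$ -/

import Mathlib

open Computability

noncomputable section

/-! ### Polynomial time and the class coC₌P -/

/-- `f` is computable by a deterministic (multi-stack) Turing machine in time polynomial in the
length of the encoded input. -/
def PolyTime {α β Γ Δ : Type} (ea : Encoding α Γ) (eb : Encoding β Δ) (f : α → β) : Prop :=
  Nonempty (Turing.TM2ComputableInPolyTime ea.encode eb.encode f)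

/-- A sign (an element of `ℤˣ = {1, -1}`) is encoded by one bit. -/
def encodingSign : Encoding ℤˣ Bool where
  encode u := [decide (u = 1)]
  decode l := some (if l = [true] then 1 else -1)
  decode_encode u := by
    rcases Int.units_eq_one_or u with rfl | rfl <;> simp

/-- A language `L ⊆ {0,1}*` is in coC₌P if there are a polynomial `p` and a polynomial-time
computable family of functions `f x : {0,1}^{p(|x|)} → {1, -1}` such that `x ∈ L` if and only if
`∑_y f x y ≠ 0`. -/
def InCoCeqP (L : Set (List Bool)) : Prop :=
  ∃ (p : Polynomial ℕ) (f : List Bool × List Bool → ℤˣ),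
    PolyTime (encodingProd (encodingList Bool) (encodingList Bool)) encodingSign f ∧
    ∀ x : List Bool,
      x ∈ L ↔ ∑ y : Fin (p.eval x.length) → Bool, (f (x, List.ofFn y) : ℤ) ≠ 0

/-- A computational problem: given an instance `a` in `inst`, output some `b` with `sol a b`.
It is coC₌P-hard if every language in coC₌P reduces to it by a deterministic polynomial-time
reduction which asks one query: `g` maps the input `x` to an instance of the problem, and `h`
decides whether `x` is in the language from `x` and from an arbitrary valid solution of `g x`. -/
def IsCoCeqPHard {α β Γ Δ : Type} (ea : Encoding α Γ) (eb : Encoding β Δ)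
    (inst : Set α) (sol : α → β → Prop) : Prop :=
  ∀ L : Set (List Bool), InCoCeqP L →
    ∃ (g : List Bool → α) (h : List Bool × β → Bool),
      PolyTime (encodingList Bool) ea g ∧
      PolyTime (encodingProd (encodingList Bool) eb) encodingBoolBool h ∧
      ∀ x : List Bool, g x ∈ inst ∧ ∀ b : β, sol (g x) b → (x ∈ L ↔ h (x, b) = true)

/-- Binary encoding of integers: a sign bit followed by the absolute value. -/
def encodingInt : Encoding ℤ Bool where
  encode a := decide (a < 0) :: encodeNat a.natAbs
  decode
    | [] => none
    | s :: l => some (if s then -(decodeNat l : ℤ) else (decodeNat l : ℤ))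
  decode_encode a := by
    by_cases ha : a < 0
    · simp [ha, abs_of_neg ha]
    · simp [ha, abs_of_nonneg (not_lt.mp ha)]

/-- Binary encoding of rational numbers by numerator and denominator. -/
def encodingRat : Encoding ℚ (Bool ⊕ Bool) where
  encode v := (encodingProd encodingInt encodingNatBool).encode (v.num, v.den)
  decode l := ((encodingProd encodingInt encodingNatBool).decode l).map
    fun p => (p.1 : ℚ) / (p.2 : ℚ)
  decode_encode v := by
    rw [Encoding.decode_encode]
    simp [Rat.num_div_den]

/-! ### IQP circuits -/

/-- A one- or two-qubit gate on `n` qubits which is diagonal in the `Z` basis. -/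
inductive DiagonalGate (n : ℕ) : Type
  | one (q : Fin n) (φ : Bool → Circle)
  | two (q r : Fin n) (hqr : q ≠ r) (φ : Bool → Bool → Circle)

/-- The phase which a diagonal gate gives to the basis state `z`. -/
def DiagonalGate.phase {n : ℕ} : DiagonalGate n → (Fin n → Bool) → Circle
  | .one q φ, z => φ (z q)
  | .two q r _ φ, z => φ (z q) (z r)

/-- The `2^n × 2^n` matrix of a diagonal gate. -/
def DiagonalGate.toMatrix {n : ℕ} (G : DiagonalGate n) :
    Matrix (Fin n → Bool) (Fin n → Bool) ℂ :=
  Matrix.diagonal fun z => (G.phase z : ℂ)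

/-- The one-qubit Hadamard gate. -/
def hadamardGate : Matrix Bool Bool ℂ :=
  Matrix.of fun a b => (if a && b then -1 else 1) / (Real.sqrt 2 : ℂ)

/-- `H^{⊗ n}`. -/
def hadamardAll (n : ℕ) : Matrix (Fin n → Bool) (Fin n → Bool) ℂ :=
  Matrix.of fun x y => ∏ i, hadamardGate (x i) (y i)

/-- An IQP circuit `H^{⊗ n} C_Z H^{⊗ n}` on `n` qubits, given by the sequence of the diagonal gates
which make up `C_Z`. -/
abbrev IQPCircuit (n : ℕ) : Type := List (DiagonalGate n)

/-- The unitary matrix of an IQP circuit (diagonal gates commute, so their order is immaterial). -/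
def IQPCircuit.unitary {n : ℕ} (C : IQPCircuit n) : Matrix (Fin n → Bool) (Fin n → Bool) ℂ :=
  hadamardAll n * (C.map DiagonalGate.toMatrix).prod * hadamardAll n

/-- The output probability `|⟨0^n| C |0^n⟩|²`. -/
def IQPCircuit.prob {n : ℕ} (C : IQPCircuit n) : ℝ :=
  ‖IQPCircuit.unitary C (fun _ => false) (fun _ => false)‖ ^ 2

/-! ### Finite descriptions of IQP circuits over the gates `S`, `T` and `CZ` -/

/-- Names of the gates `S`, `T` and `CZ` on `n` qubits. -/
inductive GateName (n : ℕ) : Type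
  | S (q : Fin n)
  | T (q : Fin n)
  | CZ (q r : Fin n) (hqr : q ≠ r)

/-- `S = diag(1, i)`, `T = diag(1, e^{iπ/4})` and `CZ = diag(1, 1, 1, -1)`. -/
def GateName.toGate {n : ℕ} : GateName n → DiagonalGate n
  | .S q => .one q fun a => if a then Circle.exp (Real.pi / 2) else 1
  | .T q => .one q fun a => if a then Circle.exp (Real.pi / 4) else 1
  | .CZ q r hqr => .two q r hqr fun a b => if a && b then Circle.exp Real.pi else 1

/-- A number of qubits together with a sequence of gate names. -/
structure IQPDescription : Type where
  qubits : ℕ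
  gates : List (GateName qubits)

/-- The IQP circuit with a given description. -/
def IQPDescription.circuit (D : IQPDescription) : IQPCircuit D.qubits :=
  D.gates.map GateName.toGate

/-- The alphabet for descriptions of circuits: a unary digit, an end marker, three gate names. -/
inductive CircuitSymbol : Type
  | one
  | mark
  | S
  | T
  | CZ

/-- The unary numeral `m`, followed by the end marker. -/
def unarySymbols (m : ℕ) : List CircuitSymbol :=
  List.replicate m CircuitSymbol.one ++ [CircuitSymbol.mark]

/-- A gate is written as its name followed by the indices of its qubits in unary. -/
def GateName.symbols {n : ℕ} : GateName n → List CircuitSymbol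
  | .S q => CircuitSymbol.S :: unarySymbols q
  | .T q => CircuitSymbol.T :: unarySymbols q
  | .CZ q r _ => CircuitSymbol.CZ :: (unarySymbols q ++ unarySymbols r)

/-- A circuit is written as its number of qubits in unary followed by its gates. -/
def IQPDescription.symbols (D : IQPDescription) : List CircuitSymbol :=
  unarySymbols D.qubits ++ D.gates.flatMap GateName.symbols

theorem unarySymbols_append_inj {a b : ℕ} {r s : List CircuitSymbol}
    (h : unarySymbols a ++ r = unarySymbols b ++ s) : a = b ∧ r = s := by
  induction a generalizing b with
  | zero => cases b <;> simp_all [unarySymbols, List.replicate_succ]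
  | succ a ih =>
    cases b with
    | zero => simp_all [unarySymbols, List.replicate_succ]
    | succ b =>
      have : unarySymbols a ++ r = unarySymbols b ++ s := by
        simpa [unarySymbols, List.replicate_succ] using h
      have := ih this
      exact ⟨by omega, this.2⟩

theorem GateName.symbols_append_inj {n : ℕ} {G G' : GateName n} {r s : List CircuitSymbol}
    (h : G.symbols ++ r = G'.symbols ++ s) : G = G' ∧ r = s := by
  cases G <;> cases G' <;>
    simp only [GateName.symbols, List.cons_append, List.append_assoc, List.cons.injEq,
      reduceCtorEq, false_and, true_and] at h
  · obtain ⟨h1, h2⟩ := unarySymbols_append_inj h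
    exact ⟨by rw [Fin.ext h1], h2⟩
  · obtain ⟨h1, h2⟩ := unarySymbols_append_inj h
    exact ⟨by rw [Fin.ext h1], h2⟩
  · obtain ⟨h1, h2⟩ := unarySymbols_append_inj h
    obtain ⟨h3, h4⟩ := unarySymbols_append_inj h2
    refine ⟨?_, h4⟩
    have h1 := Fin.ext h1
    have h3 := Fin.ext h3
    subst h1 h3
    rfl

theorem GateName.flatMap_symbols_inj {n : ℕ} {l l' : List (GateName n)}
    (h : l.flatMap GateName.symbols = l'.flatMap GateName.symbols) : l = l' := by
  induction l generalizing l' with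
  | nil =>
    cases l' with
    | nil => rfl
    | cons G l' => cases G <;> simp [GateName.symbols] at h
  | cons G l ih =>
    cases l' with
    | nil => cases G <;> simp [GateName.symbols] at h
    | cons G' l' =>
      simp only [List.flatMap_cons] at h
      obtain ⟨h1, h2⟩ := GateName.symbols_append_inj h
      rw [h1, ih h2]

theorem IQPDescription.symbols_injective : Function.Injective IQPDescription.symbols := by
  rintro ⟨n, l⟩ ⟨n', l'⟩ h
  obtain ⟨h1, h2⟩ := unarySymbols_append_inj h
  dsimp only at h1 h2
  subst h1
  rw [GateName.flatMap_symbols_inj h2]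

/-- The encoding of descriptions of circuits as strings. -/
def encodingIQP : Encoding IQPDescription CircuitSymbol where
  encode := IQPDescription.symbols
  decode := Function.partialInv IQPDescription.symbols
  decode_encode D := Function.partialInv_left IQPDescription.symbols_injective D

/-- `v` approximates the output probability of the `n`-qubit IQP circuit described by `D` to within
the additive error `1 / 2^(2n+1)`. -/
def ApproximatesProb (D : IQPDescription) (v : ℚ) : Prop :=
  |(v : ℝ) - IQPCircuit.prob D.circuit| ≤ 1 / 2 ^ (2 * D.qubits + 1)

end

/-! The amplitude ⟨0ⁿ|C|0ⁿ⟩ of an IQP circuit is 2⁻ⁿ times the sum, over all z ∈ {0,1}ⁿ, of the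
phase of the diagonal gates at z (`IQPCircuit.prob_eq`). Such sums can enforce constraints: if a bit
h is coupled by CZ gates to some other bits, then summing (-1)^(h·ℓ) over h gives 2 if their parity
ℓ is 0, and 0 otherwise. Powers of T applied to parities give CCZ, and from CCZ every Boolean
constraint on a fixed number of bits is obtained, up to a constant factor of modulus at least 1
(`Realizable.ccz`, `Realizable.indicator`).

Let L be in coC₌P with sign function f. The computation of f(x, y) is laid out as a space-time
diagram. Its cells come from a finite set; an initial segment holds x, y and blanks, and every later
cell is a fixed function of four earlier ones (`StackMachine.diagram_rec`, `InCoCeqP.exists_cells`).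
Each cell is stored in b qubits and supplied with a auxiliary qubits and gates which enforce its
local constraint; y is left free, and a sign -1 is attached where the machine outputs it. Only
assignments that describe genuine computations survive, so the total sum is c · ∑_y f(x, y) with |c|
≥ 2 (`sum_prod_cellWeight`, `exists_circuit_of_cells`). The probability is therefore S / 4ⁿ with S =
0 or S ≥ 2, and an additive error of half of 4⁻ⁿ cannot hide the difference
(`exceedsThreshold_iff`).

It remains to see that both maps of the reduction take polynomial time. A small structured stack
language is compiled to Turing machines (`StackCmd.polyTime`). The circuit is periodic, so loops
write it from finitely many gate templates with shifted indices (`Prog.exists_run_circuit`). The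
answer is read off by comparing the bit lengths of numerator and denominator, which needs only unary
counters (`Prog.polyTime_exceedsThreshold`). -/

noncomputable section

/-! ### Boolean constraints as sums of `S`, `T`, `CZ` phases over auxiliary variables -/

/-- A gate `S`, `T` or `CZ` acting on variables indexed by `ι`. -/
inductive Gate (ι : Type) : Type
  | S (i : ι)
  | T (i : ι)
  | CZ (i j : ι)

namespace Gate

variable {ι κ : Type}

/-- The primitive eighth root of unity `e^{iπ/4}`. -/
def omega : ℂ := Complex.exp (Real.pi / 4 * Complex.I)

theorem omega_sq : omega ^ 2 = Complex.I := by
  rw [omega, ← Complex.exp_nat_mul]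
  rw [show ((2 : ℕ) : ℂ) * (Real.pi / 4 * Complex.I) = Real.pi / 2 * Complex.I by push_cast; ring]
  exact Complex.exp_pi_div_two_mul_I

theorem omega_pow_four : omega ^ 4 = -1 := by
  rw [show omega ^ 4 = (omega ^ 2) ^ 2 by ring, omega_sq, Complex.I_sq]

theorem omega_pow_eight : omega ^ 8 = 1 := by
  rw [show omega ^ 8 = (omega ^ 4) ^ 2 by ring, omega_pow_four]; norm_num

/-- The phase of a gate at an assignment of the variables. -/
def phase : Gate ι → (ι → Bool) → ℂ
  | S i, z => if z i then Complex.I else 1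
  | T i, z => if z i then omega else 1
  | CZ i j, z => if z i && z j then -1 else 1

/-- Renaming of variables. -/
def map (f : ι → κ) : Gate ι → Gate κ
  | S i => S (f i)
  | T i => T (f i)
  | CZ i j => CZ (f i) (f j)

/-- The two variables of a `CZ` gate are different. -/
def Valid : Gate ι → Prop
  | CZ i j => i ≠ j
  | _ => True

theorem phase_map (f : ι → κ) (g : Gate ι) (z : κ → Bool) :
    (g.map f).phase z = g.phase (z ∘ f) := by
  cases g <;> rfl

theorem Valid.map {f : ι → κ} (hf : Function.Injective f) {g : Gate ι} (h : g.Valid) :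
    (g.map f).Valid := by
  cases g
  · trivial
  · trivial
  · exact fun e => h (hf e)

theorem map_map {μ : Type} (f : ι → κ) (f' : κ → μ) (g : Gate ι) :
    (g.map f).map f' = g.map (f' ∘ f) := by
  cases g <;> rfl

/-- The phase of a list of gates. -/
def phases (l : List (Gate ι)) (z : ι → Bool) : ℂ := (l.map fun g => g.phase z).prod

@[simp] theorem phases_nil (z : ι → Bool) : phases [] z = 1 := rfl

@[simp] theorem phases_cons (g : Gate ι) (l : List (Gate ι)) (z : ι → Bool) :
    phases (g :: l) z = g.phase z * phases l z := by
  simp [phases]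

@[simp] theorem phases_append (l l' : List (Gate ι)) (z : ι → Bool) :
    phases (l ++ l') z = phases l z * phases l' z := by
  simp [phases]

theorem phases_map (f : ι → κ) (l : List (Gate ι)) (z : κ → Bool) :
    phases (l.map (Gate.map f)) z = phases l (z ∘ f) := by
  simp [phases, Function.comp_def, phase_map]

theorem phases_replicate (n : ℕ) (g : Gate ι) (z : ι → Bool) :
    phases (List.replicate n g) z = g.phase z ^ n := by
  simp [phases]

end Gate

open Gate

/-- Up to a constant factor of modulus at least `1`, the function `W` is obtained from the phase
of a list of gates by summing over auxiliary variables. -/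
def Realizable {V : Type} (W : (V → Bool) → ℂ) : Prop :=
  ∃ (A : Type) (_ : Fintype A) (_ : DecidableEq A) (l : List (Gate (V ⊕ A))) (c : ℂ),
    (∀ g ∈ l, g.Valid) ∧ 1 ≤ ‖c‖ ∧
    ∀ x : V → Bool, ∑ a : A → Bool, phases l (Sum.elim x a) = c * W x

namespace Realizable

variable {V H : Type}

theorem of_gates (l : List (Gate V)) (hl : ∀ g ∈ l, g.Valid) : Realizable (phases l) := by
  refine ⟨Empty, inferInstance, inferInstance, l.map (Gate.map Sum.inl), 1, ?_, by simp, ?_⟩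
  · intro g hg
    obtain ⟨g', hg', rfl⟩ := List.mem_map.1 hg
    exact (hl g' hg').map Sum.inl_injective
  · intro x
    simp [phases_map, Function.comp_def]

theorem comp {V' : Type} {W : (V → Bool) → ℂ} (h : Realizable W) (f : V → V')
    (hf : Function.Injective f) : Realizable fun x : V' → Bool => W (x ∘ f) := by
  obtain ⟨A, i1, i2, l, c, hl, hc, h⟩ := h
  refine ⟨A, i1, i2, l.map (Gate.map (Sum.map f id)), c, ?_, hc, ?_⟩
  · intro g hg
    obtain ⟨g', hg', rfl⟩ := List.mem_map.1 hg
    exact (hl g' hg').map (hf.sumMap Function.injective_id)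
  · intro x
    rw [← h]
    refine Finset.sum_congr rfl fun a _ => ?_
    rw [phases_map]
    congr 1
    funext v
    cases v <;> rfl

/-- The two sets of auxiliary variables are kept disjoint, so the joint sum factors. -/
theorem mul {W W' : (V → Bool) → ℂ} (h : Realizable W) (h' : Realizable W') :
    Realizable fun x => W x * W' x := by
  obtain ⟨A, i1, i2, l, c, hl, hc, h⟩ := h
  obtain ⟨A', i1', i2', l', c', hl', hc', h'⟩ := h'
  refine ⟨A ⊕ A', inferInstance, inferInstance,
    l.map (Gate.map (Sum.map id Sum.inl)) ++ l'.map (Gate.map (Sum.map id Sum.inr)), c * c',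
    ?_, ?_, ?_⟩
  · intro g hg
    rcases List.mem_append.1 hg with hg | hg
    · obtain ⟨g', hg', rfl⟩ := List.mem_map.1 hg
      exact (hl g' hg').map (Function.injective_id.sumMap Sum.inl_injective)
    · obtain ⟨g', hg', rfl⟩ := List.mem_map.1 hg
      exact (hl' g' hg').map (Function.injective_id.sumMap Sum.inr_injective)
  · rw [norm_mul]
    nlinarith
  · intro x
    rw [show c * c' * (W x * W' x) = (c * W x) * (c' * W' x) by ring, ← h, ← h',
      Finset.sum_mul_sum, ← Fintype.sum_prod_type',
      ← (Equiv.sumArrowEquivProdArrow A A' Bool).sum_comp]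
    refine Finset.sum_congr rfl fun a _ => ?_
    rw [phases_append, phases_map, phases_map]
    congr 2 <;> (funext v; cases v <;> rfl)

/-- Auxiliary variables are summed over anyway, so a visible variable that is to be summed over can
join them. This allows gadgets to be wired together through intermediate bits. -/
theorem hide [Fintype H] [DecidableEq H] {W : (V ⊕ H → Bool) → ℂ} (h : Realizable W) :
    Realizable fun x : V → Bool => ∑ y : H → Bool, W (Sum.elim x y) := by
  obtain ⟨A, i1, i2, l, c, hl, hc, h⟩ := h
  refine ⟨H ⊕ A, inferInstance, inferInstance,
    l.map (Gate.map (Equiv.sumAssoc V H A)), c, ?_, hc, ?_⟩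
  · intro g hg
    obtain ⟨g', hg', rfl⟩ := List.mem_map.1 hg
    exact (hl g' hg').map (Equiv.injective _)
  · intro x
    rw [Finset.mul_sum]
    simp_rw [← h]
    rw [← Fintype.sum_prod_type', ← (Equiv.sumArrowEquivProdArrow H A Bool).sum_comp]
    refine Finset.sum_congr rfl fun a _ => ?_
    rw [phases_map]
    congr 1
    funext v
    rcases v with (v | v) | v <;> rfl

theorem of_const_mul {W W' : (V → Bool) → ℂ} (h : Realizable W) (d : ℂ) (hd : 1 ≤ ‖d‖)
    (e : ∀ x, W x = d * W' x) : Realizable W' := by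
  obtain ⟨A, i1, i2, l, c, hl, hc, h⟩ := h
  refine ⟨A, i1, i2, l, c * d, hl, ?_, fun x => by rw [h, e]; ring⟩
  rw [norm_mul]
  nlinarith

theorem congr {W W' : (V → Bool) → ℂ} (h : Realizable W) (e : ∀ x, W x = W' x) :
    Realizable W' := by
  rwa [← funext e]

theorem sum_unit {M : Type*} [AddCommMonoid M] (F : (Unit → Bool) → M) :
    ∑ y : Unit → Bool, F y = F (fun _ => true) + F (fun _ => false) := by
  rw [← (Equiv.funUnique Unit Bool).symm.sum_comp, Fintype.sum_bool]
  rfl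

/-- Variables `x`, `y`; the parity is kept in the auxiliary variable `inr true`. -/
theorem parity_two (k : ℕ) :
    Realizable fun x : Fin 2 → Bool => if xor (x 0) (x 1) then omega ^ k else 1 := by
  -- Summing over `h = inr ()` gives (-1)^(h(p + x₀ + x₁)), which forces `p = inl (inr ())` to equal
  -- the parity and contributes the factor 2; then `T` is applied `k` times to `p`.
  let l : List (Gate ((Fin 2 ⊕ Unit) ⊕ Unit)) :=
    [CZ (.inr ()) (.inl (.inr ())), CZ (.inr ()) (.inl (.inl 0)), CZ (.inr ()) (.inl (.inl 1))] ++
      List.replicate k (T (.inl (.inr ())))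
  have hl : ∀ g ∈ l, g.Valid := by
    simp only [l, List.mem_append, List.mem_replicate, List.mem_cons]
    rintro g ((rfl | rfl | rfl | h) | ⟨_, rfl⟩) <;> simp_all [Valid]
  refine (of_gates l hl).hide.hide.of_const_mul 2 (by norm_num) fun x => ?_
  simp only [sum_unit, l, phases_append, phases_replicate, phases_cons, phases_nil, phase]
  cases h0 : x 0 <;> cases h1 : x 1 <;> simp [h0, h1] <;> ring

theorem parity_three (k : ℕ) :
    Realizable fun x : Fin 3 → Bool =>
      if xor (xor (x 0) (x 1)) (x 2) then omega ^ k else 1 := by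
  let l : List (Gate ((Fin 3 ⊕ Unit) ⊕ Unit)) :=
    [CZ (.inr ()) (.inl (.inr ())), CZ (.inr ()) (.inl (.inl 0)), CZ (.inr ()) (.inl (.inl 1)),
      CZ (.inr ()) (.inl (.inl 2))] ++ List.replicate k (T (.inl (.inr ())))
  have hl : ∀ g ∈ l, g.Valid := by
    simp only [l, List.mem_append, List.mem_replicate, List.mem_cons]
    rintro g ((rfl | rfl | rfl | rfl | h) | ⟨_, rfl⟩) <;> simp_all [Valid]
  refine (of_gates l hl).hide.hide.of_const_mul 2 (by norm_num) fun x => ?_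
  simp only [sum_unit, l, phases_append, phases_replicate, phases_cons, phases_nil, phase]
  cases h0 : x 0 <;> cases h1 : x 1 <;> cases h2 : x 2 <;> simp [h0, h1, h2] <;> ring

/-- For bits, 4xyz = x + y + z - (x⊕y) - (x⊕z) - (y⊕z) + (x⊕y⊕z), and ω⁴ = -1. The exponent 7 stands
for -1 modulo 8. -/
theorem ccz : Realizable fun x : Fin 3 → Bool => if x 0 && x 1 && x 2 then (-1 : ℂ) else 1 := by
  have hT : Realizable (phases [T (0 : Fin 3), T 1, T 2]) := of_gates _ (by simp [Valid])
  have h01 := (parity_two 7).comp ![(0 : Fin 3), 1] (by decide)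
  have h02 := (parity_two 7).comp ![(0 : Fin 3), 2] (by decide)
  have h12 := (parity_two 7).comp ![(1 : Fin 3), 2] (by decide)
  refine ((((hT.mul h01).mul h02).mul h12).mul (parity_three 1)).congr fun x => ?_
  have e8 := omega_pow_eight
  have e4 := omega_pow_four
  have e16 : omega ^ 16 = 1 := by rw [show omega ^ 16 = (omega ^ 8) ^ 2 by ring, e8]; norm_num
  cases h0 : x 0 <;> cases h1 : x 1 <;> cases h2 : x 2 <;>
    (simp [h0, h1, h2, phase]; try (ring_nf; simp [e16, e4]))

/-- `o = (if s then a else b)` for the variables `o`, `s`, `a`, `b`. -/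
theorem mux : Realizable fun x : Fin 4 → Bool =>
    if x 0 = (if x 1 then x 2 else x 3) then (1 : ℂ) else 0 := by
  -- Modulo 2 the selected bit is b + sa + sb. With a hidden h, the phase (-1)^(h(o + b + sa + sb))
  -- needs two CZ and two CCZ gates, and its sum over h is twice the indicator.
  have h1 : Realizable (phases [CZ (.inr () : Fin 4 ⊕ Unit) (.inl 0), CZ (.inr ()) (.inl 3)]) :=
    of_gates _ (by simp [Valid])
  have h2 := ccz.comp (![.inr (), .inl 1, .inl 2] : Fin 3 → Fin 4 ⊕ Unit) (by decide)
  have h3 := ccz.comp (![.inr (), .inl 1, .inl 3] : Fin 3 → Fin 4 ⊕ Unit) (by decide)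
  refine ((h1.mul h2).mul h3).hide.of_const_mul 2 (by norm_num) fun x => ?_
  simp only [sum_unit, phases_cons, phases_nil, phase]
  cases h0 : x 0 <;> cases h1 : x 1 <;> cases h2 : x 2 <;> cases h3 : x 3 <;>
    simp [h0, h1, h2, h3] <;> norm_num

theorem eq_const (b : Bool) : Realizable fun x : Unit → Bool => if x () = b then (1 : ℂ) else 0 := by
  -- The hidden h gives (-1)^(h(x + b)); two `S` gates make the `Z` needed for b = 1.
  let l : List (Gate (Unit ⊕ Unit)) :=
    CZ (.inr ()) (.inl ()) :: if b then [S (.inr ()), S (.inr ())] else []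
  have hl : ∀ g ∈ l, g.Valid := by cases b <;> simp [l, Valid]
  refine (of_gates l hl).hide.of_const_mul 2 (by norm_num) fun x => ?_
  cases b <;> cases h : x () <;> simp [sum_unit, l, phase, h] <;> norm_num

/-- Shannon expansion on the first variable: two hidden bits are forced to be the values of the
cofactors f(1, ·) and f(0, ·), and `mux` selects between them. Exactly one choice of hidden bits
survives, so no multiplicity arises. -/
theorem graph_fin : ∀ {n : ℕ} (f : (Fin n → Bool) → Bool),
    Realizable fun x : Fin n ⊕ Unit → Bool =>
      if x (.inr ()) = f (x ∘ .inl) then (1 : ℂ) else 0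
  | 0, f => by
    refine ((eq_const (f Fin.elim0)).comp (Sum.inr : Unit → Fin 0 ⊕ Unit)
      Sum.inr_injective).congr fun x => ?_
    rw [Subsingleton.elim Fin.elim0 (x ∘ Sum.inl)]
    rfl
  | n + 1, f => by
    -- The inputs of a cofactor are the remaining variables; its output goes to the hidden bit `w`.
    let i (u : Fin n ⊕ Unit) (w : Unit ⊕ Unit) : (Fin (n + 1) ⊕ Unit) ⊕ (Unit ⊕ Unit) :=
      u.elim (fun j => .inl (.inl j.succ)) fun _ => .inr w
    have hi : ∀ w, Function.Injective fun u => i u w := by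
      rintro w (u | u) (u' | u') h <;> simp_all [i]
    have h1 := (graph_fin fun x => f (Fin.cons true x)).comp (fun u => i u (.inl ())) (hi _)
    have h0 := (graph_fin fun x => f (Fin.cons false x)).comp (fun u => i u (.inr ())) (hi _)
    have hm := mux.comp (![.inl (.inr ()), .inl (.inl 0), .inr (.inl ()), .inr (.inr ())] :
      Fin 4 → (Fin (n + 1) ⊕ Unit) ⊕ (Unit ⊕ Unit)) (by
        intro a b h
        fin_cases a <;> fin_cases b <;> simp_all)
    refine ((h1.mul h0).mul hm).hide.congr fun x => ?_
    have e : f (x ∘ Sum.inl) = f (Fin.cons (x (.inl 0)) fun j => x (.inl j.succ)) := by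
      congr 1
      funext j
      exact Fin.cases rfl (fun _ => rfl) j
    rw [e]
    change ∑ y : Unit ⊕ Unit → Bool,
      (if y (.inl ()) = f (Fin.cons true fun j => x (.inl j.succ)) then (1 : ℂ) else 0) *
      (if y (.inr ()) = f (Fin.cons false fun j => x (.inl j.succ)) then (1 : ℂ) else 0) *
      (if x (.inr ()) = (if x (.inl 0) then y (.inl ()) else y (.inr ())) then (1 : ℂ) else 0) = _
    rw [← (Equiv.sumArrowEquivProdArrow Unit Unit Bool).symm.sum_comp, Fintype.sum_prod_type,
      sum_unit, sum_unit, sum_unit]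
    simp only [Equiv.sumArrowEquivProdArrow_symm_apply_inl,
      Equiv.sumArrowEquivProdArrow_symm_apply_inr]
    cases x (.inl 0) <;>
      generalize f (Fin.cons true fun j => x (.inl j.succ)) = u <;>
      generalize f (Fin.cons false fun j => x (.inl j.succ)) = w <;>
      generalize x (.inr ()) = o <;>
      cases u <;> cases w <;> cases o <;> simp

/-- The truth value of `R` is computed into a hidden bit, which is then pinned to true. -/
theorem indicator [Finite V] (R : (V → Bool) → Prop) [DecidablePred R] :
    Realizable fun x => if R x then (1 : ℂ) else 0 := by
  obtain ⟨n, ⟨e⟩⟩ := Finite.exists_equiv_fin V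
  have h1 := (graph_fin fun x => decide (R (x ∘ e))).comp
    (Sum.map e.symm id : Fin n ⊕ Unit → V ⊕ Unit) (e.symm.injective.sumMap Function.injective_id)
  have h2 := (eq_const true).comp (Sum.inr : Unit → V ⊕ Unit) Sum.inr_injective
  refine (h1.mul h2).hide.congr fun x => ?_
  rw [sum_unit]
  have h : R (fun v => x (e.symm (e v))) ↔ R x := by simp
  change (if true = decide (R fun v => x (e.symm (e v))) then (1 : ℂ) else 0) *
    (if true = true then (1 : ℂ) else 0) +
    (if false = decide (R fun v => x (e.symm (e v))) then (1 : ℂ) else 0) *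
    (if false = true then (1 : ℂ) else 0) = _
  simp only [h]
  by_cases hR : R x <;> simp [hR]

/-- Realization with a prescribed, sufficiently large number of auxiliary variables. -/
theorem exists_list {W : (V → Bool) → ℂ} (h : Realizable W) :
    ∃ a₀ : ℕ, ∀ a ≥ a₀, ∃ (l : List (Gate (V ⊕ Fin a))) (c : ℂ),
      l.length ≤ a ∧ (∀ g ∈ l, g.Valid) ∧ 2 ≤ ‖c‖ ∧
      ∀ x : V → Bool, ∑ y : Fin a → Bool, phases l (Sum.elim x y) = c * W x := by
  obtain ⟨A, i1, i2, l, c, hl, hc, h⟩ := h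
  -- The surplus auxiliary variables are idle, and each doubles the sum. The `+ 1` guarantees at
  -- least one of them, which raises the bound on the constant from 1 to 2; the summand `l.length`
  -- makes the gate count at most `a`.
  refine ⟨Fintype.card A + 1 + l.length, fun a ha => ?_⟩
  obtain ⟨r, rfl⟩ : ∃ r, a = Fintype.card A + (r + 1) := ⟨a - Fintype.card A - 1, by omega⟩
  let e : A ⊕ Fin (r + 1) ≃ Fin (Fintype.card A + (r + 1)) :=
    ((Fintype.equivFin A).sumCongr (Equiv.refl _)).trans finSumFinEquiv
  refine ⟨l.map (Gate.map (Sum.map id (e ∘ Sum.inl))), c * 2 ^ (r + 1), ?_, ?_, ?_, ?_⟩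
  · simp; omega
  · intro g hg
    obtain ⟨g', hg', rfl⟩ := List.mem_map.1 hg
    exact (hl g' hg').map (Function.injective_id.sumMap (e.injective.comp Sum.inl_injective))
  · rw [norm_mul, norm_pow]
    have : (1 : ℝ) ≤ 2 ^ r := one_le_pow₀ (by norm_num)
    have e2 : ‖(2 : ℂ)‖ = 2 := by simp
    rw [e2, pow_succ]
    nlinarith
  · intro x
    rw [← (Equiv.arrowCongr e (Equiv.refl Bool)).sum_comp,
      ← (Equiv.sumArrowEquivProdArrow A (Fin (r + 1)) Bool).symm.sum_comp, Fintype.sum_prod_type]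
    have : ∀ (y : A → Bool) (w : Fin (r + 1) → Bool),
        phases (l.map (Gate.map (Sum.map id (e ∘ Sum.inl))))
          (Sum.elim x (Equiv.arrowCongr e (Equiv.refl Bool)
            ((Equiv.sumArrowEquivProdArrow A (Fin (r + 1)) Bool).symm (y, w)))) =
        phases l (Sum.elim x y) := by
      intro y w
      rw [phases_map]
      congr 1
      funext v
      cases v <;> simp [Equiv.arrowCongr]
    simp only [this, Finset.sum_const, ← Finset.smul_sum, h]
    simp
    ring

end Realizable

end

noncomputable section

/-! ### Space-time diagrams of stack machines -/

namespace StackMachine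

open Turing.TM2 Turing.TM2.Stmt

variable {K : Type} {Γ : K → Type} {Λ σ : Type}

/-- An action on the stacks: nothing, a push, or a pop. -/
abbrev Act (Γ : K → Type) : Type := Option (Σ k, Option (Γ k))

variable [DecidableEq K]

/-- The effect of an action on the stacks. -/
def applyAct : Act Γ → (∀ k, List (Γ k)) → ∀ k, List (Γ k)
  | none, S => S
  | some ⟨k, some a⟩, S => Function.update S k (a :: S k)
  | some ⟨k, none⟩, S => Function.update S k (S k).tail

/-- A configuration in the middle of the execution of a statement. -/
@[ext] structure MicroCfg (Γ : K → Type) (Λ σ : Type) where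
  q : Option (Stmt Γ Λ σ)
  v : σ
  stk : ∀ k, List (Γ k)

/-- The control part of an elementary step. -/
def control (M : Λ → Stmt Γ Λ σ) :
    Option (Stmt Γ Λ σ) → σ → (∀ k, Option (Γ k)) → Option (Stmt Γ Λ σ) × σ × Act Γ
  | none, v, _ => (none, v, none)
  | some (push k f q), v, _ => (some q, v, some ⟨k, some (f v)⟩)
  | some (peek k f q), v, t => (some q, f v (t k), none)
  | some (pop k f q), v, t => (some q, f v (t k), some ⟨k, none⟩)
  | some (load f q), v, _ => (some q, f v, none)
  | some (branch f q q'), v, _ => (some (cond (f v) q q'), v, none)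
  | some (goto f), v, _ => (some (M (f v)), v, none)
  | some halt, v, _ => (none, v, none)

/-- An elementary step. -/
def micro (M : Λ → Stmt Γ Λ σ) (c : MicroCfg Γ Λ σ) : MicroCfg Γ Λ σ :=
  let r := control M c.q c.v fun k => (c.stk k).head?
  ⟨r.1, r.2.1, applyAct r.2.2 c.stk⟩

/-- An upper bound for the number of elementary steps in a statement. -/
def stmtSize : Stmt Γ Λ σ → ℕ
  | push _ _ q => stmtSize q + 1
  | peek _ _ q => stmtSize q + 1
  | pop _ _ q => stmtSize q + 1
  | load _ q => stmtSize q + 1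
  | branch _ q q' => max (stmtSize q) (stmtSize q') + 1
  | goto _ => 1
  | halt => 0

/-- One machine step runs a whole statement, which is too coarse for a local rule, so it is split
into elementary steps. When the statement halts, the elementary run stops in front of `halt`, not
after it: this configuration is where the output will be read. -/
theorem micro_iterate_stepAux (M : Λ → Stmt Γ Λ σ) (q : Stmt Γ Λ σ) (v : σ)
    (S : ∀ k, List (Γ k)) :
    ∃ s ≤ stmtSize q, (micro M)^[s] ⟨some q, v, S⟩ =
      ⟨some ((stepAux q v S).l.elim halt M), (stepAux q v S).var, (stepAux q v S).stk⟩ := by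
  induction q generalizing v S with
  | push k f q ih =>
    obtain ⟨s, hs, h⟩ := ih v (Function.update S k (f v :: S k))
    exact ⟨s + 1, by simpa [stmtSize] using hs, by rw [Function.iterate_succ_apply]; exact h⟩
  | peek k f q ih =>
    obtain ⟨s, hs, h⟩ := ih (f v (S k).head?) S
    exact ⟨s + 1, by simpa [stmtSize] using hs, by rw [Function.iterate_succ_apply]; exact h⟩
  | pop k f q ih =>
    obtain ⟨s, hs, h⟩ := ih (f v (S k).head?) (Function.update S k (S k).tail)
    exact ⟨s + 1, by simpa [stmtSize] using hs, by rw [Function.iterate_succ_apply]; exact h⟩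
  | load f q ih =>
    obtain ⟨s, hs, h⟩ := ih (f v) S
    exact ⟨s + 1, by simpa [stmtSize] using hs, by rw [Function.iterate_succ_apply]; exact h⟩
  | branch f q q' ih ih' =>
    cases hf : f v
    · obtain ⟨s, hs, h⟩ := ih' v S
      refine ⟨s + 1, by simp [stmtSize, hs], ?_⟩
      rw [Function.iterate_succ_apply]
      simpa [micro, control, applyAct, hf] using h
    · obtain ⟨s, hs, h⟩ := ih v S
      refine ⟨s + 1, by simp [stmtSize, hs], ?_⟩
      rw [Function.iterate_succ_apply]
      simpa [micro, control, applyAct, hf] using h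
  | goto f => exact ⟨1, le_rfl, rfl⟩
  | halt => exact ⟨0, le_rfl, rfl⟩

theorem micro_iterate_of_halts (M : Λ → Stmt Γ Λ σ) {C : ℕ} (hC : ∀ l, stmtSize (M l) ≤ C)
    {v' : σ} {S' : ∀ k, List (Γ k)} (n : ℕ) (l : Λ) (v : σ) (S : ∀ k, List (Γ k))
    (h : (flip bind (step M))^[n] (some ⟨some l, v, S⟩) = some ⟨none, v', S'⟩) :
    ∃ s ≤ n * C, (micro M)^[s] ⟨some (M l), v, S⟩ = ⟨some halt, v', S'⟩ := by
  induction n generalizing l v S with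
  | zero => simp at h
  | succ n ih =>
    rw [Function.iterate_succ_apply] at h
    change (flip bind (step M))^[n] (some (stepAux (M l) v S)) = _ at h
    obtain ⟨s, hs, hm⟩ := micro_iterate_stepAux M (M l) v S
    have hs' := hs.trans (hC l)
    rcases hc : stepAux (M l) v S with ⟨_ | l', v₁, S₁⟩ <;> rw [hc] at h hm
    -- A step from a halted configuration yields `none`, which persists, so the run must end as soon
    -- as it has halted.
    · have : n = 0 := by
        rcases n with _ | n
        · rfl
        · rw [Function.iterate_succ_apply] at h
          change (flip bind (step M))^[n] none = _ at h
          have hn : ∀ n, (flip bind (step M))^[n] none = none := fun n =>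
            Function.iterate_fixed rfl n
          rw [hn] at h
          cases h
      subst this
      simp only [Function.iterate_zero, id, Option.some.injEq, Cfg.mk.injEq, true_and] at h
      refine ⟨s, by simpa using hs', ?_⟩
      rw [hm, h.1, h.2]
      rfl
    · obtain ⟨s', hs'', h'⟩ := ih l' v₁ S₁ h
      refine ⟨s' + s, by linarith [Nat.succ_mul n C], ?_⟩
      rw [Function.iterate_add_apply, hm]
      exact h'

theorem applyAct_length (a : Act Γ) (S : ∀ k, List (Γ k)) (k : K) :
    (applyAct a S k).length ≤ (S k).length + 1 := by
  rcases a with _ | ⟨k', _ | x⟩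
  · simp [applyAct]
  all_goals
    by_cases h : k = k'
    · subst h
      simp [applyAct]
      try omega
    · simp [applyAct, h]

/-- A cell of the space-time diagram. A control cell contains the state of the control; the other
cells contain, for each stack, its symbol at a certain depth. All cells of a row contain the last
action. -/
@[ext] structure Cell (Γ : K → Type) (Λ σ : Type) where
  ctl : Option (Option (Stmt Γ Λ σ) × σ)
  content : ∀ k, Option (Γ k)
  act : Act Γ
  neg : Bool

/-- The symbol of stack `k` at some depth after an action, from the symbols around this depth. -/
def newSymbol (a : Act Γ) (k : K) (top : Bool) (l c r : Option (Γ k)) : Option (Γ k) :=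
  match a with
  | none => c
  | some ⟨k', o⟩ =>
    if h : k' = k then
      match o with
      | some x => if top then some (h ▸ x) else l
      | none => r
    else c

/-- A push or pop shifts a stack by one place, so the new symbol at depth `i` depends only on depths
`i - 1`, `i`, `i + 1`. At the top there is no symbol above, whence the flag `top`. -/
theorem applyAct_getElem? (a : Act Γ) (S : ∀ k, List (Γ k)) (k : K) (i : ℕ) (top : Bool)
    (l : Option (Γ k)) (ht : top = true ↔ i = 0) (hl : i ≠ 0 → l = (S k)[i - 1]?) :
    (applyAct a S k)[i]? = newSymbol a k top l (S k)[i]? (S k)[i + 1]? := by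
  rcases a with _ | ⟨k', _ | x⟩
  · rfl
  · by_cases h : k' = k
    · subst h
      simp [applyAct, newSymbol]
    · simp [applyAct, newSymbol, h, Ne.symm h]
  · by_cases h : k' = k
    · subst h
      rcases i with _ | i
      · simp [applyAct, newSymbol, ht.2 rfl]
      · have : top = false := by simpa using mt ht.1 (by omega)
        simp [applyAct, newSymbol, this, hl (by omega)]
    · simp [applyAct, newSymbol, h, Ne.symm h]

/-- Is the statement to be executed `halt`? -/
def isHalt : Option (Stmt Γ Λ σ) → Bool
  | some halt => true
  | _ => false

theorem isHalt_iff {q : Option (Stmt Γ Λ σ)} : isHalt q = true ↔ q = some halt := by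
  rcases q with _ | _ | _ | _ | _ | _ | _ | _ <;> simp [isHalt]

/-- The local rule of the space-time diagram: a cell is determined by three cells of the row above
and by its left neighbour. -/
def nextCell (M : Λ → Stmt Γ Λ σ) (out : (∀ k, Option (Γ k)) → Bool)
    (l c r left : Cell Γ Λ σ) : Cell Γ Λ σ :=
  match c.ctl with
  | some (q, v) =>
    ⟨some ((control M q v r.content).1, (control M q v r.content).2.1), fun _ => none,
      (control M q v r.content).2.2, isHalt q && out r.content⟩
  | none =>
    ⟨none, fun k => newSymbol left.act k l.ctl.isSome (l.content k) (c.content k) (r.content k),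
      left.act, false⟩

/-- The action which is performed on a configuration. -/
def cfgAct (M : Λ → Stmt Γ Λ σ) (c : MicroCfg Γ Λ σ) : Act Γ :=
  (control M c.q c.v fun k => (c.stk k).head?).2.2

/-- The cells of the space-time diagram. -/
def cellAt (M : Λ → Stmt Γ Λ σ) (out : (∀ k, Option (Γ k)) → Bool) (conf : ℕ → MicroCfg Γ Λ σ) :
    ℕ → ℕ → Cell Γ Λ σ
  | 0, 0 => ⟨some ((conf 0).q, (conf 0).v), fun _ => none, none, false⟩
  | 0, i + 1 => ⟨none, fun k => ((conf 0).stk k)[i]?, none, false⟩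
  | t + 1, 0 => ⟨some ((conf (t + 1)).q, (conf (t + 1)).v), fun _ => none, cfgAct M (conf t),
      isHalt (conf t).q && out fun k => ((conf t).stk k).head?⟩
  | t + 1, i + 1 => ⟨none, fun k => ((conf (t + 1)).stk k)[i]?, cfgAct M (conf t), false⟩

/-- An empty cell. -/
def emptyCell (Γ : K → Type) (Λ σ : Type) : Cell Γ Λ σ := ⟨none, fun _ => none, none, false⟩

/-- The rows of the space-time diagram, one after another, preceded by an empty cell. -/
def diagram (M : Λ → Stmt Γ Λ σ) (out : (∀ k, Option (Γ k)) → Bool)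
    (conf : ℕ → MicroCfg Γ Λ σ) (m : ℕ) : ℕ → Cell Γ Λ σ
  | 0 => emptyCell Γ Λ σ
  | j + 1 => cellAt M out conf (j / (m + 1)) (j % (m + 1))

theorem diagram_eq (M : Λ → Stmt Γ Λ σ) (out : (∀ k, Option (Γ k)) → Bool)
    (conf : ℕ → MicroCfg Γ Λ σ) (m t i : ℕ) (hi : i ≤ m) :
    diagram M out conf m (t * (m + 1) + i + 1) = cellAt M out conf t i := by
  have h1 : (t * (m + 1) + i) / (m + 1) = t := by
    rw [add_comm, Nat.add_mul_div_right _ _ (by omega), Nat.div_eq_of_lt (by omega), zero_add]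
  have h2 : (t * (m + 1) + i) % (m + 1) = i := by
    rw [add_comm, Nat.add_mul_mod_self_right, Nat.mod_eq_of_lt (by omega)]
  rw [diagram, h1, h2]

variable (M : Λ → Stmt Γ Λ σ) (out : (∀ k, Option (Γ k)) → Bool)

theorem cellAt_content_succ (conf : ℕ → MicroCfg Γ Λ σ) (t i : ℕ) :
    (cellAt M out conf t (i + 1)).content = fun k => ((conf t).stk k)[i]? := by
  cases t <;> rfl

theorem cellAt_content_zero (conf : ℕ → MicroCfg Γ Λ σ) (t : ℕ) :
    (cellAt M out conf t 0).content = fun _ => none := by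
  cases t <;> rfl

theorem cellAt_ctl_succ (conf : ℕ → MicroCfg Γ Λ σ) (t i : ℕ) :
    (cellAt M out conf t (i + 1)).ctl = none := by
  cases t <;> rfl

theorem cellAt_ctl_zero (conf : ℕ → MicroCfg Γ Λ σ) (t : ℕ) :
    (cellAt M out conf t 0).ctl = some ((conf t).q, (conf t).v) := by
  cases t <;> rfl

theorem cellAt_act (conf : ℕ → MicroCfg Γ Λ σ) (t i : ℕ) :
    (cellAt M out conf (t + 1) i).act = cfgAct M (conf t) := by
  cases i <;> rfl

/-- Rows have `m + 1` cells, a control cell and `m` stack cells, so position `j + m + 2` lies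
directly below `j + 1`. A control cell needs only the control and the stack tops to its right in the
row above. A stack cell learns the current action from its left neighbour, along which the action is
passed through the row. -/
theorem diagram_rec {conf : ℕ → MicroCfg Γ Λ σ} (hconf : ∀ t, conf (t + 1) = micro M (conf t))
    {m : ℕ} (hm : 1 ≤ m) (hlen : ∀ t k, ((conf t).stk k).length ≤ m) (j : ℕ) :
    diagram M out conf m (j + m + 2) = nextCell M out (diagram M out conf m j)
      (diagram M out conf m (j + 1)) (diagram M out conf m (j + 2))
      (diagram M out conf m (j + m + 1)) := by
  obtain ⟨t, i, hi, rfl⟩ : ∃ t i, i ≤ m ∧ j = t * (m + 1) + i :=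
    ⟨j / (m + 1), j % (m + 1), Nat.lt_succ_iff.1 (Nat.mod_lt _ (by omega)), by
      rw [mul_comm]; exact (Nat.div_add_mod _ _).symm⟩
  have e1 : t * (m + 1) + i + m + 2 = (t + 1) * (m + 1) + i + 1 := by ring
  rw [e1, diagram_eq _ _ _ _ _ _ hi, diagram_eq _ _ _ _ _ _ hi]
  rcases i with _ | i
  · have e2 : t * (m + 1) + 0 + 2 = t * (m + 1) + 1 + 1 := by ring
    rw [e2, diagram_eq _ _ _ _ _ _ hm, nextCell, cellAt_ctl_zero, cellAt_content_succ]
    simp only [← List.head?_eq_getElem?]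
    simp [cellAt, hconf t, micro, cfgAct]
  · have e3 : t * (m + 1) + (i + 1) + m + 1 = (t + 1) * (m + 1) + i + 1 := by ring
    rw [nextCell, cellAt_ctl_succ, e3, diagram_eq _ _ _ _ _ _ (by omega),
      ← add_assoc, diagram_eq _ _ _ _ _ _ (by omega), cellAt_act]
    have hr : (diagram M out conf m (t * (m + 1) + i + 1 + 2)).content =
        fun k => ((conf t).stk k)[i + 1]? := by
      rcases hi.lt_or_eq with hi' | rfl
      · have : t * (m + 1) + i + 1 + 2 = t * (m + 1) + (i + 1 + 1) + 1 := by ring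
        rw [this, diagram_eq _ _ _ _ _ _ (by omega), cellAt_content_succ]
      -- At the end of a row the right neighbour wraps around to the next control cell. Its contents
      -- are empty, as required, because no stack is longer than `m`.
      · have : t * (i + 1 + 1) + i + 1 + 2 = (t + 1) * (i + 1 + 1) + 0 + 1 := by ring
        rw [this, diagram_eq M out conf (i + 1) (t + 1) 0 (by omega), cellAt_content_zero]
        funext k
        exact (List.getElem?_eq_none (hlen t k)).symm
    rw [hr, cellAt_content_succ]
    ext1
    · simp [cellAt]
    · funext k
      rw [show (cellAt M out conf (t + 1) (i + 1)).content k =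
        (applyAct (cfgAct M (conf t)) (conf t).stk k)[i]? by
          rw [cellAt_content_succ, hconf]; rfl]
      refine applyAct_getElem? _ _ k i _ _ ?_ ?_
      · rcases i with _ | i
        · simp [cellAt_ctl_zero]
        · simp [cellAt_ctl_succ]
      · intro h
        obtain ⟨i, rfl⟩ := Nat.exists_eq_succ_of_ne_zero h
        rw [cellAt_content_succ]
        rfl
    · simp [cellAt]
    · simp [cellAt]

/-! Only finitely many cells occur. -/

/-- The statements which can occur in a computation. -/
def reachableStmts : Set (Stmt Γ Λ σ) := {q | ∃ l, q ∈ stmts₁ (M l)}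

theorem finite_reachableStmts [Finite Λ] : (reachableStmts M).Finite := by
  have : reachableStmts M = ⋃ l, (stmts₁ (M l) : Set (Stmt Γ Λ σ)) := by
    ext q
    simp [reachableStmts]
  rw [this]
  exact Set.finite_iUnion fun l => (stmts₁ (M l)).finite_toSet

/-- The symbol pushed by a statement. -/
def pushSymbol : Stmt Γ Λ σ → σ → Option (Σ k, Γ k)
  | push k f _, v => some ⟨k, f v⟩
  | _, _ => none

/-- The symbols which can occur in a computation with input on stack `k₀`. -/
def reachableSymbols (k₀ : K) : Set (Σ k, Γ k) :=
  Set.range (Sigma.mk k₀) ∪ {s | ∃ q ∈ reachableStmts M, ∃ v, pushSymbol q v = some s}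

/-- Only the input alphabet is assumed finite. On the other stacks only pushed symbols can occur,
and finitely many statements and internal states push finitely many symbols. -/
theorem finite_reachableSymbols [Finite Λ] [Finite σ] (k₀ : K) [Finite (Γ k₀)] :
    (reachableSymbols M k₀).Finite := by
  refine (Set.finite_range _).union ?_
  refine Set.Finite.subset (Set.Finite.preimage (f := some) (Option.some_injective _).injOn
    (((finite_reachableStmts M).prod (Set.finite_univ (α := σ))).image
      fun p => pushSymbol p.1 p.2)) ?_
  rintro s ⟨q, hq, v, h⟩
  exact ⟨(q, v), ⟨hq, trivial⟩, h⟩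

/-- A configuration which contains only reachable statements and symbols. -/
def MicroCfg.Bounded (k₀ : K) (c : MicroCfg Γ Λ σ) : Prop :=
  (∀ q, c.q = some q → q ∈ reachableStmts M) ∧ ∀ k, ∀ a ∈ c.stk k, ⟨k, a⟩ ∈ reachableSymbols M k₀

/-- An action which involves only reachable symbols. -/
def actBounded (k₀ : K) : Act Γ → Prop
  | some ⟨k, some a⟩ => ⟨k, a⟩ ∈ reachableSymbols M k₀
  | _ => True

theorem reachableStmts_of_mem {q q' : Stmt Γ Λ σ} (h : q ∈ reachableStmts M)
    (h' : q' ∈ stmts₁ q) : q' ∈ reachableStmts M := by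
  obtain ⟨l, hl⟩ := h
  exact ⟨l, stmts₁_trans hl h'⟩

theorem actBounded_control (k₀ : K) {q : Option (Stmt Γ Λ σ)}
    (hq : ∀ q', q = some q' → q' ∈ reachableStmts M) (v : σ) (t : ∀ k, Option (Γ k)) :
    actBounded M k₀ (control M q v t).2.2 := by
  rcases q with _ | q
  · trivial
  · cases q with
    | push k f q => exact Or.inr ⟨_, hq _ rfl, v, rfl⟩
    | _ => trivial

theorem reachable_control {q : Option (Stmt Γ Λ σ)}
    (hq : ∀ q', q = some q' → q' ∈ reachableStmts M) (v : σ) (t : ∀ k, Option (Γ k)) :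
    ∀ q', (control M q v t).1 = some q' → q' ∈ reachableStmts M := by
  rcases q with _ | q
  · simp [control]
  · have hq := hq q rfl
    cases q with
    | branch f q₁ q₂ =>
      rintro _ ⟨⟩
      refine reachableStmts_of_mem M hq ?_
      cases f v <;> simp [stmts₁, stmts₁_self]
    | goto f =>
      rintro _ ⟨⟩
      exact ⟨_, stmts₁_self⟩
    | halt => simp [control]
    | _ =>
      rintro _ ⟨⟩
      exact reachableStmts_of_mem M hq (by simp [stmts₁, stmts₁_self])

theorem MicroCfg.Bounded.micro {k₀ : K} {c : MicroCfg Γ Λ σ} (h : c.Bounded M k₀) :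
    (micro M c).Bounded M k₀ := by
  refine ⟨reachable_control M h.1 _ _, ?_⟩
  have ha := actBounded_control M k₀ h.1 c.v fun k => (c.stk k).head?
  simp only [StackMachine.micro]
  generalize (control M c.q c.v fun k => (c.stk k).head?).2.2 = a at ha
  intro k x hx
  rcases a with _ | ⟨k', _ | y⟩
  · exact h.2 k x hx
  · by_cases e : k = k'
    · subst e
      simp only [applyAct, Function.update_self] at hx
      exact h.2 k x (List.mem_of_mem_tail hx)
    · simp only [applyAct, Function.update_of_ne e] at hx
      exact h.2 k x hx
  · by_cases e : k = k'
    · subst e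
      simp only [applyAct, Function.update_self, List.mem_cons] at hx
      rcases hx with rfl | hx
      · exact ha
      · exact h.2 k x hx
    · simp only [applyAct, Function.update_of_ne e] at hx
      exact h.2 k x hx

/-- The cells which can occur in a space-time diagram. -/
def reachableCells (k₀ : K) : Set (Cell Γ Λ σ) :=
  {c | (∀ q v, c.ctl = some (some q, v) → q ∈ reachableStmts M) ∧
    (∀ k a, c.content k = some a → ⟨k, a⟩ ∈ reachableSymbols M k₀) ∧ actBounded M k₀ c.act}

theorem finite_reachableCells [Finite K] [Finite Λ] [Finite σ] (k₀ : K) [Finite (Γ k₀)] :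
    (reachableCells M k₀).Finite := by
  have hq := finite_reachableStmts M
  have hs := finite_reachableSymbols M k₀
  let Q : Set (Option (Option (Stmt Γ Λ σ) × σ)) :=
    insert none (some '' ((insert none (some '' reachableStmts M)) ×ˢ Set.univ))
  have hQ : Q.Finite := ((((hq.image _).insert _).prod Set.finite_univ).image _).insert _
  let G (k : K) : Set (Option (Γ k)) :=
    insert none (some '' (Sigma.mk k ⁻¹' reachableSymbols M k₀))
  have hG : ∀ k, (G k).Finite := fun k =>
    ((hs.preimage sigma_mk_injective.injOn).image _).insert _
  let T : Set (Act Γ) :=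
    insert none ((Set.range fun k => some ⟨k, none⟩) ∪
      ((fun s => some ⟨s.1, some s.2⟩) '' reachableSymbols M k₀))
  have hT : T.Finite := ((Set.finite_range _).union (hs.image _)).insert _
  refine ((hQ.prod ((Set.Finite.pi hG).prod (hT.prod (Set.finite_univ (α := Bool))))).image
    fun p => (⟨p.1, p.2.1, p.2.2.1, p.2.2.2⟩ : Cell Γ Λ σ)).subset ?_
  rintro ⟨ctl, content, act, neg⟩ ⟨h1, h2, h3⟩
  refine ⟨(ctl, content, act, neg), ⟨?_, ?_, ?_, trivial⟩, rfl⟩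
  · rcases ctl with _ | ⟨_ | q, v⟩
    · exact Or.inl rfl
    · exact Or.inr ⟨_, ⟨Or.inl rfl, trivial⟩, rfl⟩
    · exact Or.inr ⟨_, ⟨Or.inr ⟨q, h1 _ _ rfl, rfl⟩, trivial⟩, rfl⟩
  · intro k _
    change content k ∈ G k
    rcases h : content k with _ | a
    · exact Or.inl rfl
    · exact Or.inr ⟨a, h2 k a h, rfl⟩
  · rcases act with _ | ⟨k, _ | a⟩
    · exact Or.inl rfl
    · exact Or.inr (Or.inl ⟨k, rfl⟩)
    · exact Or.inr (Or.inr ⟨⟨k, a⟩, h3, rfl⟩)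

theorem diagram_mem {k₀ : K} {conf : ℕ → MicroCfg Γ Λ σ} (h : ∀ t, (conf t).Bounded M k₀)
    (m j : ℕ) : diagram M out conf m j ∈ reachableCells M k₀ := by
  rcases j with _ | j
  · exact ⟨by simp [diagram, emptyCell], by simp [diagram, emptyCell], trivial⟩
  · rw [diagram]
    generalize j / (m + 1) = t
    generalize j % (m + 1) = i
    refine ⟨?_, ?_, ?_⟩
    · intro q v e
      rcases i with _ | i
      · rw [cellAt_ctl_zero] at e
        simp only [Option.some.injEq, Prod.mk.injEq] at e
        exact (h t).1 q e.1
      · rw [cellAt_ctl_succ] at e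
        cases e
    · intro k a e
      rcases i with _ | i
      · rw [cellAt_content_zero] at e
        cases e
      · rw [cellAt_content_succ] at e
        exact (h t).2 k a (List.mem_of_getElem? e)
    · rcases t with _ | t
      · cases i <;> trivial
      · rw [cellAt_act]
        exact actBounded_control M k₀ (h t).1 _ _

end StackMachine

end

/-! ### From halting machines to cell sequences for coC₌P -/

noncomputable section

namespace StackMachine

open Turing Turing.TM2 Turing.TM2.Stmt

section Halting

variable {K : Type} [DecidableEq K] {Γ : K → Type} {Λ σ : Type} {M : Λ → Stmt Γ Λ σ}

theorem micro_iterate_halted (v : σ) (S : ∀ k, List (Γ k)) (t : ℕ) :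
    (micro M)^[t] ⟨none, v, S⟩ = ⟨none, v, S⟩ :=
  Function.iterate_fixed rfl t

theorem micro_iterate_after {c : MicroCfg Γ Λ σ} {h : ℕ} {v : σ} {S : ∀ k, List (Γ k)}
    (hh : (micro M)^[h] c = ⟨some halt, v, S⟩) {t : ℕ} (ht : h < t) :
    (micro M)^[t] c = ⟨none, v, S⟩ := by
  obtain ⟨s, rfl⟩ : ∃ s, t = s + 1 + h := ⟨t - h - 1, by omega⟩
  rw [Function.iterate_add_apply, hh, Function.iterate_succ_apply]
  exact micro_iterate_halted v S s

/-- After `halt` the statement is `none` for ever, so `halt` is met at one time only. This ensures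
that the output sign is counted exactly once. -/
theorem isHalt_iterate {c : MicroCfg Γ Λ σ} {h : ℕ} {v : σ} {S : ∀ k, List (Γ k)}
    (hh : (micro M)^[h] c = ⟨some halt, v, S⟩) (t : ℕ) :
    isHalt ((micro M)^[t] c).q = true ↔ t = h := by
  rw [isHalt_iff]
  constructor
  · intro ht
    by_contra hne
    rcases lt_or_gt_of_ne hne with h' | h'
    · have := micro_iterate_after (c := c) (h := t) (v := ((micro M)^[t] c).v)
        (S := ((micro M)^[t] c).stk) (MicroCfg.ext ht rfl rfl) h'
      rw [hh] at this
      cases this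
    · rw [micro_iterate_after hh h'] at ht
      cases ht
  · rintro rfl
    rw [hh]

theorem length_iterate (c : MicroCfg Γ Λ σ) (t : ℕ) (k : K) :
    (((micro M)^[t] c).stk k).length ≤ (c.stk k).length + t := by
  induction t with
  | zero => simp
  | succ t ih =>
    rw [Function.iterate_succ_apply']
    exact (applyAct_length _ _ k).trans (by omega)

theorem length_le_of_halts {c : MicroCfg Γ Λ σ} {h : ℕ} {v : σ} {S : ∀ k, List (Γ k)}
    (hh : (micro M)^[h] c = ⟨some halt, v, S⟩) (t : ℕ) (k : K) :
    (((micro M)^[t] c).stk k).length ≤ (c.stk k).length + h := by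
  rcases le_or_gt t h with ht | ht
  · exact (length_iterate c t k).trans (by omega)
  · have := length_iterate (M := M) c h k
    rw [hh] at this
    rwa [micro_iterate_after hh ht]

/-- The product of the signs of all cells is the sign with which the machine halts. -/
theorem prod_neg_diagram (out : (∀ k, Option (Γ k)) → Bool) {c : MicroCfg Γ Λ σ} {h : ℕ} {v : σ}
    {S : ∀ k, List (Γ k)} (hh : (micro M)^[h] c = ⟨some halt, v, S⟩) (m Q : ℕ)
    (hQ : h * (m + 1) < Q) :
    ∏ j ∈ Finset.range Q,
      (if (diagram M out (fun t => (micro M)^[t] c) m (j + m + 2)).neg then (-1 : ℤ) else 1) =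
      if out fun k => (S k).head? then -1 else 1 := by
  -- Position `h * (m + 1) + m + 2` is the control cell of row `h + 1`, directly below the row which
  -- reaches `halt`.
  rw [Finset.prod_eq_single (h * (m + 1))]
  · have : h * (m + 1) + m + 2 = (h + 1) * (m + 1) + 0 + 1 := by ring
    rw [this, diagram_eq _ _ _ m (h + 1) 0 (by omega)]
    simp [cellAt, hh, isHalt]
  · intro j _ hj
    obtain ⟨t, i, hi, rfl⟩ : ∃ t i, i ≤ m ∧ j = t * (m + 1) + i :=
      ⟨j / (m + 1), j % (m + 1), Nat.lt_succ_iff.1 (Nat.mod_lt _ (by omega)), by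
        rw [mul_comm]; exact (Nat.div_add_mod _ _).symm⟩
    have e1 : t * (m + 1) + i + m + 2 = (t + 1) * (m + 1) + i + 1 := by ring
    rw [e1, diagram_eq _ _ _ _ _ _ hi]
    rcases i with _ | i
    · have hne : ¬ isHalt ((micro M)^[t] c).q = true := by
        rw [isHalt_iterate hh]
        rintro rfl
        exact hj rfl
      simp only [Bool.not_eq_true] at hne
      simp [cellAt, hne]
    · simp [cellAt]
  · intro hn
    exact absurd (Finset.mem_range.2 hQ) hn

end Halting

/-- The initial configuration of a machine. -/
def initCfg (tm : FinTM2) (s : List (tm.Γ tm.k₀)) : MicroCfg tm.Γ tm.Λ tm.σ :=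
  ⟨some (tm.m tm.main), tm.initialState, (initList tm s).stk⟩

theorem initList_stk_self (tm : FinTM2) (s : List (tm.Γ tm.k₀)) :
    (initList tm s).stk tm.k₀ = s := by
  simp [initList]

theorem initList_stk_of_ne (tm : FinTM2) (s : List (tm.Γ tm.k₀)) {k : tm.K} (h : k ≠ tm.k₀) :
    (initList tm s).stk k = [] := by
  simp [initList, h]

theorem haltList_stk_self (tm : FinTM2) (s : List (tm.Γ tm.k₁)) :
    (haltList tm s).stk tm.k₁ = s := by
  simp [haltList]

/-- The cells which contain an input symbol. -/
def inputCell (tm : FinTM2) (a : Option (tm.Γ tm.k₀)) : Cell tm.Γ tm.Λ tm.σ :=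
  ⟨none, fun k => if h : k = tm.k₀ then h ▸ a else none, none, false⟩

theorem cellAt_zero_succ (tm : FinTM2) (out : (∀ k, Option (tm.Γ k)) → Bool)
    (s : List (tm.Γ tm.k₀)) (i : ℕ) :
    cellAt tm.m out (fun t => (micro tm.m)^[t] (initCfg tm s)) 0 (i + 1) =
      inputCell tm s[i]? := by
  rw [cellAt, inputCell]
  congr 1
  funext k
  by_cases h : k = tm.k₀
  · subst h
    simp [initCfg, initList_stk_self]
  · simp [initCfg, initList_stk_of_ne tm s h, h]

theorem initCfg_bounded (tm : FinTM2) (s : List (tm.Γ tm.k₀)) :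
    (initCfg tm s).Bounded tm.m tm.k₀ := by
  constructor
  · rintro q ⟨⟩
    exact ⟨_, stmts₁_self⟩
  · intro k a ha
    by_cases h : k = tm.k₀
    · subst h
      exact Or.inl ⟨a, rfl⟩
    · simp [initCfg, initList_stk_of_ne tm s h] at ha

end StackMachine

open StackMachine Turing

/-- Membership in a language of coC₌P is expressed by sequences of cells from a finite set, where
all but a few cells are determined by the preceding ones through a local rule. -/
theorem InCoCeqP.exists_cells {L : Set (List Bool)} (hL : InCoCeqP L) :
    ∃ (C : Type) (A : Set C) (fn : C → C → C → C → C) (neg : C → Bool) (c₀ c₁ ce : C)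
      (cx cy : Bool → C) (p E Q : Polynomial ℕ), A.Finite ∧ cy true ≠ cy false ∧
      ∀ x : List Bool, 2 ≤ E.eval x.length ∧
      ∃ hist : (Fin (p.eval x.length) → Bool) → ℕ → C,
        (∀ y j, hist y j ∈ A) ∧ (∀ y, hist y 0 = c₀) ∧ (∀ y, hist y 1 = c₁) ∧
        (∀ y (i : Fin x.length), hist y (i + 2) = cx (x.get i)) ∧
        (∀ y (i : Fin (p.eval x.length)), hist y (x.length + i + 2) = cy (y i)) ∧
        (∀ y, ∀ i < E.eval x.length, hist y (x.length + p.eval x.length + i + 2) = ce) ∧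
        (∀ y j, hist y (j + (x.length + p.eval x.length + E.eval x.length) + 2) =
          fn (hist y j) (hist y (j + 1)) (hist y (j + 2))
            (hist y (j + (x.length + p.eval x.length + E.eval x.length) + 1))) ∧
        (x ∈ L ↔ ∑ y, ∏ j ∈ Finset.range (Q.eval x.length),
          (if neg (hist y (j + (x.length + p.eval x.length + E.eval x.length) + 2))
            then (-1 : ℤ) else 1) ≠ 0) := by
  obtain ⟨p, f, ⟨T⟩, hL⟩ := hL
  let tm := T.tm
  obtain ⟨C, hC⟩ : ∃ C, ∀ l, stmtSize (tm.m l) ≤ C := by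
    have := tm.ΛFin
    exact ⟨Finset.univ.sup fun l => stmtSize (tm.m l), fun l =>
      Finset.le_sup (f := fun l => stmtSize (tm.m l)) (Finset.mem_univ l)⟩
  -- The sign -1 is encoded by the bit `false`.
  let out (t : ∀ k, Option (tm.Γ k)) : Bool :=
    (t tm.k₁).map T.outputAlphabet == some false
  -- `X + p` is the length of the encoded pair and `C` bounds the elementary steps per machine step.
  -- The summand 2 later keeps the five cells involved in a local rule distinct.
  let E : Polynomial ℕ := T.time.comp (Polynomial.X + p) * Polynomial.C C + 2
  -- This is row width times `E`, enough cells to include the row after halting.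
  let Q : Polynomial ℕ := (Polynomial.X + p + E + 1) * E
  let inp (x y : List Bool) : List (tm.Γ tm.k₀) :=
    (x.map Sum.inl ++ y.map Sum.inr).map T.inputAlphabet.symm
  have := tm.ΛFin
  have := tm.σFin
  have := tm.kFin
  have := tm.Γk₀Fin
  refine ⟨Cell tm.Γ tm.Λ tm.σ, reachableCells tm.m tm.k₀, nextCell tm.m out, Cell.neg,
    emptyCell _ _ _, ⟨some (some (tm.m tm.main), tm.initialState), fun _ => none, none, false⟩,
    inputCell tm none, fun b => inputCell tm (some (T.inputAlphabet.symm (.inl b))),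
    fun b => inputCell tm (some (T.inputAlphabet.symm (.inr b))), p, E, Q,
    finite_reachableCells _ _, ?_, fun x => ⟨by simp [E], ?_⟩⟩
  · intro h
    have := congrFun (congrArg Cell.content h) tm.k₀
    simp [inputCell] at this
  set m := x.length + p.eval x.length + E.eval x.length with hm
  let c (y : Fin (p.eval x.length) → Bool) := initCfg tm (inp x (List.ofFn y))
  have hlen : ∀ y : Fin (p.eval x.length) → Bool,
      (inp x (List.ofFn y)).length = x.length + p.eval x.length := by simp [inp]
  have key : ∀ y : Fin (p.eval x.length) → Bool, ∃ h v S, h + 2 ≤ E.eval x.length ∧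
      (micro tm.m)^[h] (c y) = ⟨some TM2.Stmt.halt, v, S⟩ ∧
      out (fun k => (S k).head?) = decide (f (x, List.ofFn y) = -1) := by
    intro y
    have ho := T.outputsFun (x, List.ofFn y)
    obtain ⟨s, hs, hh⟩ := micro_iterate_of_halts tm.m hC ho.steps tm.main tm.initialState
      (initList tm (inp x (List.ofFn y))).stk ho.evals_in_steps
    refine ⟨s, _, _, ?_, hh, ?_⟩
    · have h1 : ho.steps ≤ T.time.eval ((encodingProd (encodingList Bool)
          (encodingList Bool)).encode (x, List.ofFn y)).length := ho.steps_le_m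
      have h2 : ((encodingProd (encodingList Bool) (encodingList Bool)).encode
          (x, List.ofFn y)).length = x.length + p.eval x.length := by
        simp [encodingProd, encodingList]
      have h1 := h1.trans_eq (congrArg (fun n => T.time.eval n) h2)
      have h3 := Nat.mul_le_mul_right C h1
      simp only [E, Polynomial.eval_add, Polynomial.eval_mul, Polynomial.eval_comp,
        Polynomial.eval_X, Polynomial.eval_C, Polynomial.eval_ofNat]
      omega
    · have e := haltList_stk_self tm
        (List.map T.outputAlphabet.invFun (encodingSign.encode (f (x, List.ofFn y))))
      change (Option.map T.outputAlphabet ((haltList tm (List.map T.outputAlphabet.invFun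
        (encodingSign.encode (f (x, List.ofFn y))))).stk tm.k₁).head? == some false) = _
      rw [e]
      rcases Int.units_eq_one_or (f (x, List.ofFn y)) with h | h <;> rw [h] <;>
        simp [encodingSign]
  have hrow : ∀ y i, i ≤ m → diagram tm.m out (fun t => (micro tm.m)^[t] (c y)) m (i + 1) =
      cellAt tm.m out (fun t => (micro tm.m)^[t] (c y)) 0 i := by
    intro y i hi
    have := diagram_eq tm.m out (fun t => (micro tm.m)^[t] (c y)) m 0 i hi
    rwa [zero_mul, zero_add] at this
  refine ⟨fun y => diagram tm.m out (fun t => (micro tm.m)^[t] (c y)) m, ?_, fun _ => rfl,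
    ?_, ?_, ?_, ?_, ?_, ?_⟩
  · intro y j
    refine diagram_mem tm.m out (fun t => ?_) m j
    induction t with
    | zero => exact initCfg_bounded tm _
    | succ t ih =>
      rw [Function.iterate_succ_apply']
      exact ih.micro
  · intro y
    exact hrow y 0 (by omega)
  · intro y i
    have hi := i.isLt
    refine (hrow y (i + 1) (by omega)).trans ?_
    rw [cellAt_zero_succ]
    simp [inp, List.getElem?_append_left, hi]
  · intro y i
    have hi := i.isLt
    refine (hrow y (x.length + i + 1) (by omega)).trans ?_
    rw [cellAt_zero_succ]
    simp [inp]
  · intro y i hi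
    refine (hrow y (x.length + p.eval x.length + i + 1) (by omega)).trans ?_
    rw [cellAt_zero_succ, List.getElem?_eq_none (by rw [hlen]; omega)]
  · intro y j
    obtain ⟨h, v, S, hE, hh, -⟩ := key y
    refine diagram_rec tm.m out (fun t => Function.iterate_succ_apply' _ _ _) (by omega) ?_ j
    intro t k
    refine (length_le_of_halts hh t k).trans ?_
    by_cases hk : k = tm.k₀
    · subst hk
      rw [show (c y).stk tm.k₀ = _ from initList_stk_self tm _, hlen]
      omega
    · rw [show (c y).stk k = _ from initList_stk_of_ne tm _ hk, List.length_nil]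
      omega
  · rw [hL]
    refine not_congr (Eq.congr_left (Finset.sum_congr rfl fun y _ => ?_))
    obtain ⟨h, v, S, hE, hh, ho⟩ := key y
    rw [prod_neg_diagram out hh, ho]
    · rcases Int.units_eq_one_or (f (x, List.ofFn y)) with h | h <;> rw [h] <;> simp
    · have : Q.eval x.length = (m + 1) * E.eval x.length := by
        simp [Q, hm]
      rw [this, mul_comm]
      exact Nat.mul_lt_mul_of_pos_left (by omega) (by omega)

end

noncomputable section

/-! ### A structured language for stack machines -/

/-- Structured programs which operate on stacks. -/
inductive StackCmd {K : Type} (Γ : K → Type) : Type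
  | skip
  | push (k : K) (a : Γ k)
  | seq (c d : StackCmd Γ)
  | pop (k : K) (f : Option (Γ k) → StackCmd Γ)
  | loop (k : K) (f : Γ k → StackCmd Γ)

namespace StackCmd

open Turing

variable {K : Type} {Γ : K → Type}

/-- The labels of the compiled program. -/
def Lab : StackCmd Γ → Type
  | skip => Unit
  | push _ _ => Unit
  | seq c d => Lab c ⊕ Lab d
  | pop _ f => Unit ⊕ Σ o, Lab (f o)
  | loop _ f => Unit ⊕ Σ a, Lab (f a)

theorem finite_lab [∀ k, Finite (Γ k)] : ∀ c : StackCmd Γ, Finite c.Lab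
  | skip => inferInstanceAs (Finite Unit)
  | push _ _ => inferInstanceAs (Finite Unit)
  | seq c d => by
    have := finite_lab c
    have := finite_lab d
    exact inferInstanceAs (Finite (Lab c ⊕ Lab d))
  | pop _ f => by
    have := fun o => finite_lab (f o)
    exact inferInstanceAs (Finite (Unit ⊕ Σ o, Lab (f o)))
  | loop _ f => by
    have := fun o => finite_lab (f o)
    exact inferInstanceAs (Finite (Unit ⊕ Σ o, Lab (f o)))

/-- The label where a program starts. -/
def entry : ∀ c : StackCmd Γ, c.Lab
  | skip => ()
  | push _ _ => ()
  | seq c _ => Sum.inl (entry c)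
  | pop _ _ => Sum.inl ()
  | loop _ _ => Sum.inl ()

variable [DecidableEq K]

/-- The symbol of stack `k` which is stored in the internal state. -/
def stored (k : K) (v : Option (Σ k, Γ k)) : Option (Γ k) :=
  v.bind fun s => if h : s.1 = k then some (h ▸ s.2) else none

@[simp] theorem stored_map (k : K) (o : Option (Γ k)) : stored k (o.map (Sigma.mk k)) = o := by
  cases o <;> simp [stored]

/-- The compiled program. -/
def code : ∀ (c : StackCmd Γ) {L : Type}, (c.Lab → L) → L → c.Lab →
    TM2.Stmt Γ L (Option (Σ k, Γ k))
  | skip, _, _, exit, _ => TM2.Stmt.goto fun _ => exit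
  | push k a, _, _, exit, _ => TM2.Stmt.push k (fun _ => a) (TM2.Stmt.goto fun _ => exit)
  | seq c d, _, emb, exit, l =>
    match l with
    | Sum.inl l => code c (fun l => emb (Sum.inl l)) (emb (Sum.inr (entry d))) l
    | Sum.inr l => code d (fun l => emb (Sum.inr l)) exit l
  | pop k f, _, emb, exit, l =>
    match l with
    | Sum.inl () => TM2.Stmt.pop k (fun _ o => o.map (Sigma.mk k))
        (TM2.Stmt.goto fun v => emb (Sum.inr ⟨stored k v, entry _⟩))
    | Sum.inr ⟨o, l⟩ => code (f o) (fun l => emb (Sum.inr ⟨o, l⟩)) exit l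
  | loop k f, _, emb, exit, l =>
    match l with
    | Sum.inl () => TM2.Stmt.pop k (fun _ o => o.map (Sigma.mk k))
        (TM2.Stmt.goto fun v => (stored k v).elim exit fun a => emb (Sum.inr ⟨a, entry _⟩))
    | Sum.inr ⟨a, l⟩ => code (f a) (fun l => emb (Sum.inr ⟨a, l⟩)) (emb (Sum.inl ())) l

/-- `Exec c S S' t`: the program `c` changes the stacks from `S` to `S'` in `t` steps. -/
inductive Exec : StackCmd Γ → (∀ k, List (Γ k)) → (∀ k, List (Γ k)) → ℕ → Prop
  | skip (S) : Exec skip S S 1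
  | push (k a S) : Exec (push k a) S (Function.update S k (a :: S k)) 1
  | seq {c d S S₁ S₂ t t'} : Exec c S S₁ t → Exec d S₁ S₂ t' → Exec (seq c d) S S₂ (t' + t)
  | pop {k f S S₁ t} : Exec (f (S k).head?) (Function.update S k (S k).tail) S₁ t →
      Exec (pop k f) S S₁ (t + 1)
  | loop_nil {k f S} : S k = [] → Exec (loop k f) S S 1
  | loop_cons {k f S S₁ S₂ a l t t'} : S k = a :: l →
      Exec (f a) (Function.update S k l) S₁ t → Exec (loop k f) S₁ S₂ t' →
      Exec (loop k f) S S₂ (t' + t + 1)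

theorem code_entry_pop (k : K) (f : Option (Γ k) → StackCmd Γ) {L : Type}
    (emb : (pop k f).Lab → L) (exit : L) :
    code (pop k f) emb exit (entry _) = TM2.Stmt.pop k (fun _ o => o.map (Sigma.mk k))
      (TM2.Stmt.goto fun v => emb (Sum.inr ⟨stored k v, entry _⟩)) := rfl

theorem code_entry_loop (k : K) (f : Γ k → StackCmd Γ) {L : Type}
    (emb : (loop k f).Lab → L) (exit : L) :
    code (loop k f) emb exit (entry _) = TM2.Stmt.pop k (fun _ o => o.map (Sigma.mk k))
      (TM2.Stmt.goto fun v => (stored k v).elim exit fun a => emb (Sum.inr ⟨a, entry _⟩)) := rfl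

/-- The embedding of labels and the exit label are arbitrary so that the induction can treat a
subprogram inside a larger machine. The initial internal state is arbitrary too, since it only
carries a popped symbol to the next jump. -/
theorem Exec.eval {c : StackCmd Γ} {S S' : ∀ k, List (Γ k)} {t : ℕ} (h : Exec c S S' t)
    {L : Type} {M : L → TM2.Stmt Γ L (Option (Σ k, Γ k))} {emb : c.Lab → L} {exit : L}
    (hM : ∀ l, M (emb l) = code c emb exit l) (v : Option (Σ k, Γ k)) :
    ∃ v', (flip bind (TM2.step M))^[t] (some ⟨some (emb (entry c)), v, S⟩) =
      some ⟨some exit, v', S'⟩ := by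
  induction h generalizing L v with
  | skip S =>
    refine ⟨v, ?_⟩
    change some (TM2.stepAux (M (emb _)) v S) = _
    rw [hM]
    rfl
  | push k a S =>
    refine ⟨v, ?_⟩
    change some (TM2.stepAux (M (emb _)) v S) = _
    rw [hM]
    rfl
  | @seq c d S S₁ S₂ t t' _ _ ih ih' =>
    obtain ⟨v₁, h₁⟩ := ih (emb := fun l => emb (Sum.inl l)) (exit := emb (Sum.inr (entry d)))
      (fun l => hM (Sum.inl l)) v
    obtain ⟨v₂, h₂⟩ := ih' (emb := fun l => emb (Sum.inr l)) (exit := exit)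
      (fun l => hM (Sum.inr l)) v₁
    refine ⟨v₂, ?_⟩
    rw [Function.iterate_add_apply, show entry (StackCmd.seq c d) = Sum.inl (entry c) from rfl, h₁, h₂]
  | @pop k f S S₁ t _ ih =>
    obtain ⟨v₁, h₁⟩ := ih (emb := fun l => emb (Sum.inr ⟨_, l⟩)) (exit := exit)
      (fun l => hM (Sum.inr ⟨_, l⟩)) ((S k).head?.map (Sigma.mk k))
    refine ⟨v₁, ?_⟩
    rw [Function.iterate_succ_apply]
    change (flip bind (TM2.step M))^[t] (some (TM2.stepAux (M (emb (entry _))) v S)) = _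
    rw [hM, ← h₁, code_entry_pop]
    simp only [TM2.stepAux]
    rw [stored_map]
  | @loop_nil k f S hS =>
    refine ⟨none, ?_⟩
    change some (TM2.stepAux (M (emb (entry _))) v S) = _
    rw [hM, code_entry_loop]
    simp only [TM2.stepAux]
    have hu : Function.update S k (S k).tail = S := by
      rw [Function.update_eq_self_iff, hS, List.tail_nil]
    rw [stored_map, hu, hS]
    rfl
  | @loop_cons k f S S₁ S₂ a l t t' hS _ _ ih ih' =>
    obtain ⟨v₁, h₁⟩ := ih (emb := fun l => emb (Sum.inr ⟨_, l⟩)) (exit := emb (Sum.inl ()))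
      (fun l => hM (Sum.inr ⟨_, l⟩)) (some ⟨k, a⟩)
    obtain ⟨v₂, h₂⟩ := ih' hM v₁
    refine ⟨v₂, ?_⟩
    rw [Function.iterate_succ_apply]
    change (flip bind (TM2.step M))^[t' + t] (some (TM2.stepAux (M (emb (entry _))) v S)) = _
    rw [Function.iterate_add_apply, hM, code_entry_loop]
    simp only [TM2.stepAux]
    rw [stored_map, hS]
    simp only [List.head?_cons, Option.elim_some, Option.map_some, List.tail_cons]
    rw [h₁]
    exact h₂

/-- The machine which runs a program. -/
def machine [Fintype K] [∀ k, Fintype (Γ k)] (c : StackCmd Γ) (k₀ k₁ : K) : FinTM2 where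
  k₀ := k₀
  k₁ := k₁
  Γ := Γ
  Λ := c.Lab ⊕ Unit
  main := Sum.inl (entry c)
  ΛFin := by
    have := finite_lab c
    exact Fintype.ofFinite _
  σ := Option (Σ k, Γ k)
  initialState := none
  -- The internal state is reset because `haltList` prescribes the initial one; this costs one extra
  -- machine step.
  m := Sum.elim (code c Sum.inl (Sum.inr ())) fun _ => TM2.Stmt.load (fun _ => none) TM2.Stmt.halt

theorem polyTime [Fintype K] [∀ k, Fintype (Γ k)] (c : StackCmd Γ) (k₀ k₁ : K)
    {α β Γ₀ Γ₁ : Type} {ea : Encoding α Γ₀} {eb : Encoding β Γ₁} {f : α → β}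
    (e₀ : Γ k₀ ≃ Γ₀) (e₁ : Γ k₁ ≃ Γ₁) (P : Polynomial ℕ)
    (h : ∀ a, ∃ t ≤ P.eval (ea.encode a).length,
      Exec c (Function.update (fun _ => []) k₀ ((ea.encode a).map e₀.symm))
        (Function.update (fun _ => []) k₁ ((eb.encode (f a)).map e₁.symm)) t) :
    PolyTime ea eb f := by
  refine ⟨⟨⟨machine c k₀ k₁, e₀, e₁⟩, P + 1, fun a => ?_⟩⟩
  have hs : ∀ k : K, ∀ s : List (Γ k),
      (fun k' => @dite (List (Γ k')) (k' = k) (inferInstance) (fun h => by rw [h]; exact s)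
        fun _ => []) = Function.update (fun _ => []) k s := by
    intro k s
    funext k'
    by_cases hk : k' = k
    · subst hk
      simp
    · simp [hk]
  refine ⟨⟨(h a).choose + 1, ?_⟩, ?_⟩
  · obtain ⟨v, hv⟩ := (h a).choose_spec.2.eval (M := (machine c k₀ k₁).m) (emb := Sum.inl)
      (exit := Sum.inr ()) (fun l => rfl) none
    have h0 : initList (machine c k₀ k₁) ((ea.encode a).map e₀.symm) =
        ⟨some (Sum.inl (entry c)), none,
          Function.update (fun _ => []) k₀ ((ea.encode a).map e₀.symm)⟩ :=
      congrArg (fun S => (⟨some (Sum.inl (entry c)), none, S⟩ : (machine c k₀ k₁).Cfg)) (hs _ _)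
    have h1 : haltList (machine c k₀ k₁) ((eb.encode (f a)).map e₁.symm) =
        ⟨none, none, Function.update (fun _ => []) k₁ ((eb.encode (f a)).map e₁.symm)⟩ :=
      congrArg (fun S => (⟨none, none, S⟩ : (machine c k₀ k₁).Cfg)) (hs _ _)
    rw [Function.iterate_succ_apply']
    refine (congrArg (flip bind (machine c k₀ k₁).step)
      ((congrArg _ (congrArg some h0)).trans hv)).trans ?_
    exact congrArg some h1.symm
  · simpa using (h a).choose_spec.1

/-! ### Time-bounded execution -/

/-- `Runs c S S' n`: the program `c` changes the stacks from `S` to `S'` in at most `n` steps. -/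
def Runs (c : StackCmd Γ) (S S' : ∀ k, List (Γ k)) (n : ℕ) : Prop := ∃ t ≤ n, Exec c S S' t

theorem Runs.mono {c : StackCmd Γ} {S S' : ∀ k, List (Γ k)} {n n' : ℕ} (h : Runs c S S' n)
    (hn : n ≤ n') : Runs c S S' n' := by
  obtain ⟨t, ht, h⟩ := h
  exact ⟨t, ht.trans hn, h⟩

theorem Runs.seq {c d : StackCmd Γ} {S S₁ S₂ : ∀ k, List (Γ k)} {n n' : ℕ} (h : Runs c S S₁ n)
    (h' : Runs d S₁ S₂ n') : Runs (seq c d) S S₂ (n + n') := by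
  obtain ⟨t, ht, h⟩ := h
  obtain ⟨t', ht', h'⟩ := h'
  exact ⟨_, by omega, h.seq h'⟩

theorem Runs.loop {k : K} {f : Γ k → StackCmd Γ} {n : ℕ} (N : ℕ) (F : ℕ → ∀ k, List (Γ k))
    (hcons : ∀ i < N, ∃ a l, F i k = a :: l ∧ Runs (f a) (Function.update (F i) k l) (F (i + 1)) n)
    (hnil : F N k = []) : Runs (loop k f) (F 0) (F N) (N * (n + 1) + 1) := by
  induction N generalizing F with
  | zero => exact ⟨1, by omega, .loop_nil hnil⟩
  | succ N ih =>
    obtain ⟨t', ht', h'⟩ := ih (fun i => F (i + 1)) (fun i hi => hcons (i + 1) (by omega)) hnil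
    obtain ⟨a, l, e, t, ht, h⟩ := hcons 0 (by omega)
    refine ⟨_, ?_, .loop_cons e h h'⟩
    rw [Nat.succ_mul]
    omega

/-- The `n`-fold repetition of a program. -/
def rep (c : StackCmd Γ) : ℕ → StackCmd Γ
  | 0 => skip
  | n + 1 => seq c (rep c n)

theorem Runs.rep {c : StackCmd Γ} {n : ℕ} (N : ℕ) (F : ℕ → ∀ k, List (Γ k))
    (h : ∀ i < N, Runs c (F i) (F (i + 1)) n) : Runs (c.rep N) (F 0) (F N) (N * n + 1) := by
  induction N generalizing F with
  | zero => exact ⟨1, by omega, .skip _⟩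
  | succ N ih =>
    refine ((h 0 (by omega)).seq
      (ih (fun i => F (i + 1)) fun i hi => h (i + 1) (by omega))).mono ?_
    rw [Nat.succ_mul]
    omega

end StackCmd

end

noncomputable section

/-! ### Programs with counters -/

/-- The counters of a program. -/
inductive Ctr : Type
  | x | x' | a | a' | j | j' | v | v'
  deriving DecidableEq

instance : Fintype Ctr := ⟨{.x, .x', .a, .a', .j, .j', .v, .v'}, fun c => by cases c <;> simp⟩

/-- The stacks of a program: input, output and counters. -/
inductive Stk : Type
  | inp
  | out
  | ctr (c : Ctr)
  deriving DecidableEq, Fintype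

/-- The alphabets of the stacks. -/
abbrev Alph (I O : Type) : Stk → Type
  | .inp => I
  | .out => O
  | .ctr _ => Unit

instance (I O : Type) [Fintype I] [Fintype O] : ∀ k, Fintype (Alph I O k)
  | .inp => inferInstanceAs (Fintype I)
  | .out => inferInstanceAs (Fintype O)
  | .ctr _ => inferInstanceAs (Fintype Unit)

/-- The contents of the stacks of a program. -/
@[ext] structure Store (I O : Type) where
  inp : List I
  out : List O
  ctr : Ctr → ℕ

namespace Store

variable {I O : Type}

/-- The stacks of a store. -/
def stk (s : Store I O) : ∀ k, List (Alph I O k)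
  | .inp => s.inp
  | .out => s.out
  | .ctr c => List.replicate (s.ctr c) ()

/-- Change of a counter. -/
def set (s : Store I O) (c : Ctr) (n : ℕ) : Store I O :=
  { s with ctr := Function.update s.ctr c n }

/-- Change of the output. -/
def setOut (s : Store I O) (l : List O) : Store I O := { s with out := l }

/-- Change of the input. -/
def setInp (s : Store I O) (l : List I) : Store I O := { s with inp := l }

@[simp] theorem set_inp (s : Store I O) (c : Ctr) (n : ℕ) : (s.set c n).inp = s.inp := rfl
@[simp] theorem set_out (s : Store I O) (c : Ctr) (n : ℕ) : (s.set c n).out = s.out := rfl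
@[simp] theorem set_ctr (s : Store I O) (c d : Ctr) (n : ℕ) :
    (s.set c n).ctr d = if d = c then n else s.ctr d := by
  simp [set, Function.update_apply]
@[simp] theorem setOut_inp (s : Store I O) (l : List O) : (s.setOut l).inp = s.inp := rfl
@[simp] theorem setOut_out (s : Store I O) (l : List O) : (s.setOut l).out = l := rfl
@[simp] theorem setOut_ctr (s : Store I O) (l : List O) : (s.setOut l).ctr = s.ctr := rfl
@[simp] theorem setInp_inp (s : Store I O) (l : List I) : (s.setInp l).inp = l := rfl
@[simp] theorem setInp_out (s : Store I O) (l : List I) : (s.setInp l).out = s.out := rfl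
@[simp] theorem setInp_ctr (s : Store I O) (l : List I) : (s.setInp l).ctr = s.ctr := rfl

theorem update_ctr (s : Store I O) (c : Ctr) (n : ℕ) :
    Function.update s.stk (.ctr c) (List.replicate n ()) = (s.set c n).stk := by
  funext k
  rcases k with _ | _ | d
  · simp [stk]
  · simp [stk]
  · by_cases h : d = c
    · subst h
      simp [stk]
    · simp [stk, h]

theorem update_out (s : Store I O) (l : List O) :
    Function.update s.stk .out l = (s.setOut l).stk := by
  funext k
  cases k <;> simp [stk]

theorem update_inp (s : Store I O) (l : List I) :
    Function.update s.stk .inp l = (s.setInp l).stk := by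
  funext k
  cases k <;> simp [stk]

end Store

/-- Programs with input alphabet `I` and output alphabet `O`. -/
abbrev Prog (I O : Type) : Type := StackCmd (Alph I O)

namespace Prog

open StackCmd

variable {I O : Type}

/-- The program `c` leads from the store `s` to the store `s'` in at most `n` steps. -/
def Run (c : Prog I O) (s s' : Store I O) (n : ℕ) : Prop := c.Runs s.stk s'.stk n

theorem Run.mono {c : Prog I O} {s s' : Store I O} {n n' : ℕ} (h : c.Run s s' n) (hn : n ≤ n') :
    c.Run s s' n' := Runs.mono h hn

theorem Run.seq {c d : Prog I O} {s s₁ s₂ : Store I O} {n n' : ℕ} (h : c.Run s s₁ n)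
    (h' : d.Run s₁ s₂ n') : Run (.seq c d) s s₂ (n + n') := Runs.seq h h'

theorem run_skip (s : Store I O) : Run .skip s s 1 := ⟨1, le_rfl, .skip _⟩

/-- Increase a counter. -/
def inc (c : Ctr) : Prog I O := .push (.ctr c) ()

theorem run_inc (c : Ctr) (s : Store I O) : (inc c).Run s (s.set c (s.ctr c + 1)) 1 := by
  refine ⟨1, le_rfl, ?_⟩
  rw [← Store.update_ctr]
  exact .push _ _ _

/-- Write a symbol. -/
def write (a : O) : Prog I O := .push .out a

theorem run_write (a : O) (s : Store I O) : (write a).Run s (s.setOut (a :: s.out)) 1 := by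
  refine ⟨1, le_rfl, ?_⟩
  rw [← Store.update_out]
  exact .push _ _ _

/-- Execute a program while a counter is positive, decreasing the counter. -/
def whilePos (c : Ctr) (p : Prog I O) : Prog I O := .loop (.ctr c) fun _ => p

theorem run_whilePos {c : Ctr} {p : Prog I O} {n N : ℕ} (F : ℕ → Store I O)
    (hF : ∀ i ≤ N, (F i).ctr c = N - i)
    (h : ∀ i < N, p.Run ((F i).set c (N - (i + 1))) (F (i + 1)) n) :
    (whilePos c p).Run (F 0) (F N) (N * (n + 1) + 1) := by
  refine Runs.loop N (fun i => (F i).stk) (fun i hi => ?_) ?_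
  · refine ⟨(), List.replicate (N - (i + 1)) (), ?_, ?_⟩
    · rw [Store.stk, hF i hi.le, ← List.replicate_succ]
      congr 1
      omega
    · rw [Store.update_ctr]
      exact h i hi
  · simp [Store.stk, hF N le_rfl]

/-- Execute a program for each symbol of the input. -/
def forInput (p : I → Prog I O) : Prog I O := .loop .inp p

theorem run_forInput {p : I → Prog I O} {n : ℕ} (l : List I) (F : ℕ → Store I O)
    (hF : ∀ i ≤ l.length, (F i).inp = l.drop i)
    (h : ∀ i (hi : i < l.length), (p l[i]).Run ((F i).setInp (l.drop (i + 1))) (F (i + 1)) n) :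
    (forInput p).Run (F 0) (F l.length) (l.length * (n + 1) + 1) := by
  refine Runs.loop l.length (fun i => (F i).stk) (fun i hi => ?_) ?_
  · refine ⟨l[i], l.drop (i + 1), ?_, ?_⟩
    · rw [Store.stk, hF i hi.le]
      exact List.drop_eq_getElem_cons hi
    · rw [Store.update_inp]
      exact h i hi
  · simp [Store.stk, hF l.length le_rfl]

/-- Case distinction for a counter, which is decreased if it is positive. -/
def test (c : Ctr) (p q : Prog I O) : Prog I O := .pop (.ctr c) fun o => o.elim p fun _ => q

theorem run_test_zero {c : Ctr} {p q : Prog I O} {s s' : Store I O} {n : ℕ} (hs : s.ctr c = 0)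
    (h : p.Run s s' n) : (test c p q).Run s s' (n + 1) := by
  obtain ⟨t, ht, h⟩ := h
  refine ⟨t + 1, by omega, .pop ?_⟩
  have e : Function.update s.stk (.ctr c) (s.stk (.ctr c)).tail = s.stk := by
    rw [Function.update_eq_self_iff]
    simp [Store.stk, hs]
  rw [e]
  simpa [Store.stk, hs] using h

theorem run_test_succ {c : Ctr} {p q : Prog I O} {s s' : Store I O} {n k : ℕ}
    (hs : s.ctr c = k + 1) (h : q.Run (s.set c k) s' n) : (test c p q).Run s s' (n + 1) := by
  obtain ⟨t, ht, h⟩ := h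
  refine ⟨t + 1, by omega, .pop ?_⟩
  have e : s.stk (.ctr c) = () :: List.replicate k () := by
    simp [Store.stk, hs, List.replicate_succ]
  rw [e, List.tail_cons, Store.update_ctr]
  exact h

/-- Add a constant to a counter. -/
def incs (c : Ctr) (n : ℕ) : Prog I O := (inc c).rep n

theorem run_incs (c : Ctr) (n : ℕ) (s : Store I O) :
    (incs c n).Run s (s.set c (s.ctr c + n)) (n + 1) := by
  have h := Runs.rep (c := (inc c : Prog I O)) (n := 1) n
    (fun i => (s.set c (s.ctr c + i)).stk) (fun i _ => ?_)
  · have e : s.set c (s.ctr c + 0) = s := by ext d <;> simp +contextual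
    rw [e, mul_one] at h
    exact h
  · have := run_inc c (s.set c (s.ctr c + i))
    have e : (s.set c (s.ctr c + i)).set c ((s.set c (s.ctr c + i)).ctr c + 1) =
        s.set c (s.ctr c + (i + 1)) := by
      ext d
      · rfl
      · rfl
      · simp only [Store.set_ctr]
        split_ifs <;> omega
    rw [e] at this
    exact this

/-- Write a symbol several times. -/
def writes (a : O) (n : ℕ) : Prog I O := (write a).rep n

theorem run_writes (a : O) (n : ℕ) (s : Store I O) :
    (writes a n).Run s (s.setOut (List.replicate n a ++ s.out)) (n + 1) := by
  have h := Runs.rep (c := (write a : Prog I O)) (n := 1) n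
    (fun i => (s.setOut (List.replicate i a ++ s.out)).stk) (fun i _ => ?_)
  · rw [mul_one] at h
    exact h
  · exact run_write a (s.setOut (List.replicate i a ++ s.out))

/-- Add a counter to another one and clear it. -/
def transfer (c d : Ctr) : Prog I O := whilePos c (inc d)

theorem run_transfer {c d : Ctr} (hcd : c ≠ d) (s : Store I O) :
    (transfer c d).Run s ((s.set d (s.ctr d + s.ctr c)).set c 0) (s.ctr c * 2 + 1) := by
  have h := run_whilePos (c := c) (p := (inc d : Prog I O)) (n := 1) (N := s.ctr c)
    (fun i => (s.set d (s.ctr d + i)).set c (s.ctr c - i)) (fun i _ => by simp) fun i hi => ?_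
  · have e : (s.set d (s.ctr d + 0)).set c (s.ctr c - 0) = s := by
      ext e <;> simp only [Store.set_ctr, Store.set_out, Store.set_inp]
      split_ifs <;> simp_all
    rw [e, Nat.sub_self] at h
    exact h
  · convert run_inc d _ using 1
    ext e <;> simp only [Store.set_ctr, Store.set_out, Store.set_inp]
    split_ifs <;> simp_all <;> omega

/-- Clear a counter. -/
def clear (c : Ctr) : Prog I O := whilePos c .skip

theorem run_clear (c : Ctr) (s : Store I O) :
    (clear c).Run s (s.set c 0) (s.ctr c * 2 + 1) := by
  have h := run_whilePos (c := c) (p := (.skip : Prog I O)) (n := 1) (N := s.ctr c)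
    (fun i => s.set c (s.ctr c - i)) (fun i _ => by simp) fun i hi => ?_
  · have e : s.set c (s.ctr c - 0) = s := by
      ext e <;> simp only [Store.set_ctr, Store.set_out, Store.set_inp]
      split_ifs <;> simp_all
    rw [e, Nat.sub_self] at h
    exact h
  · convert run_skip _ using 1
    ext e <;> simp only [Store.set_ctr, Store.set_out, Store.set_inp]
    split_ifs <;> simp_all

/-! #### Evaluation of polynomials -/

/-- Add the counter `x` to the counter `a`. -/
def addX : Prog I O := .seq (whilePos .x (.seq (inc .x') (inc .a))) (transfer .x' .x)

theorem run_addX (s : Store I O) (hx : s.ctr .x' = 0) :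
    addX.Run s (s.set .a (s.ctr .a + s.ctr .x)) (s.ctr .x * 5 + 2) := by
  have h := run_whilePos (c := .x) (p := (.seq (inc .x') (inc .a) : Prog I O)) (n := 2)
    (N := s.ctr .x)
    (fun i => ((s.set .x' i).set .a (s.ctr .a + i)).set .x (s.ctr .x - i)) (fun i _ => by simp)
    fun i hi => ?_
  · have e : ((s.set .x' 0).set .a (s.ctr .a + 0)).set .x (s.ctr .x - 0) = s := by
      ext e <;> simp only [Store.set_ctr, Store.set_out, Store.set_inp]
      split_ifs <;> simp_all
    rw [e] at h
    refine Run.mono (s' := s.set .a (s.ctr .a + s.ctr .x))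
      (h.seq (n' := s.ctr .x * 2 + 1) ?_) (by omega)
    convert run_transfer (c := .x') (d := .x) (by decide) _ using 1
    · ext e <;> simp
      cases e <;> simp [hx]
    · simp
  · convert (run_inc .x' _).seq (run_inc .a _) using 1
    ext e <;> simp only [Store.set_ctr, Store.set_out, Store.set_inp]
    cases e <;> simp <;> omega

/-- Multiply the counter `a` by the counter `x`. -/
def mulX : Prog I O := .seq (transfer .a .a') (whilePos .a' addX)

theorem run_mulX (s : Store I O) (hx : s.ctr .x' = 0) (ha : s.ctr .a' = 0) :
    mulX.Run s (s.set .a (s.ctr .a * s.ctr .x)) (s.ctr .a * (s.ctr .x * 5 + 5) + 2) := by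
  have h := run_whilePos (c := .a') (p := (addX : Prog I O)) (n := s.ctr .x * 5 + 2)
    (N := s.ctr .a)
    (fun i => (s.set .a (i * s.ctr .x)).set .a' (s.ctr .a - i)) (fun i _ => by simp)
    fun i hi => ?_
  · refine Run.mono (s' := s.set .a (s.ctr .a * s.ctr .x))
      ((run_transfer (by decide) s).seq (n' := s.ctr .a * (s.ctr .x * 5 + 2 + 1) + 1) ?_) (by
        rw [Nat.mul_add, Nat.mul_add, Nat.mul_add]; omega)
    convert h using 1
    · ext e <;> simp
      cases e <;> simp [ha]
    · ext e <;> simp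
      cases e <;> simp [ha]
  · convert run_addX _ _ using 1
    · ext e <;> simp only [Store.set_ctr, Store.set_out, Store.set_inp]
      cases e <;> simp
      ring
    · simp
    · simp [hx]

/-- The values of a polynomial are computed in polynomial time. -/
theorem exists_run_eval (p : Polynomial ℕ) : ∃ (c : ∀ I O, Prog I O) (T : Polynomial ℕ),
    ∀ (I O : Type) (s : Store I O), s.ctr .x' = 0 → s.ctr .a = 0 → s.ctr .a' = 0 →
      (c I O).Run s (s.set .a (p.eval (s.ctr .x))) (T.eval (s.ctr .x)) := by
  -- Horner's scheme: p = `p.divX` · X + `p.coeff 0`, where the quotient has smaller degree.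
  induction hn : p.natDegree generalizing p with
  | zero =>
    obtain ⟨k, rfl⟩ : ∃ k, p = Polynomial.C k := ⟨_, Polynomial.eq_C_of_natDegree_eq_zero hn⟩
    refine ⟨fun _ _ => incs .a k, Polynomial.C (k + 1), fun I O s _ ha _ => ?_⟩
    have := run_incs .a k s
    rw [ha, zero_add] at this
    simpa using this
  | succ n ih =>
    obtain ⟨c, T, h⟩ := ih p.divX (by rw [Polynomial.natDegree_divX_eq_natDegree_tsub_one, hn]; rfl)
    refine ⟨fun I O => .seq (c I O) (.seq mulX (incs .a (p.coeff 0))),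
      T + (p.divX * (Polynomial.X * 5 + 5) + 2 + (Polynomial.C (p.coeff 0) + 1)), ?_⟩
    intro I O s hx ha ha'
    have h1 := h I O s hx ha ha'
    have h2 := run_mulX (s.set .a (p.divX.eval (s.ctr .x))) (by simpa using hx) (by simpa using ha')
    have h3 := h1.seq (h2.seq (run_incs .a (p.coeff 0) _))
    have e : p.eval (s.ctr .x) = p.divX.eval (s.ctr .x) * s.ctr .x + p.coeff 0 := by
      conv_lhs => rw [← p.divX_mul_X_add]
      simp
    convert h3 using 1
    · rw [e]
      ext d
      · rfl
      · rfl
      · by_cases hd : d = .a <;> simp [hd]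
    · simp

end Prog

end

noncomputable section

/-! ### The program which writes the circuit -/

namespace Gate

/-- The symbols of a gate. -/
def symbols : Gate ℕ → List CircuitSymbol
  | S i => CircuitSymbol.S :: unarySymbols i
  | T i => CircuitSymbol.T :: unarySymbols i
  | CZ i j => CircuitSymbol.CZ :: (unarySymbols i ++ unarySymbols j)

/-- The value of a reference: `(e, c)` refers to `J + V + c` or to `J + c`. -/
def refIndex (J V : ℕ) (e : Bool × ℕ) : ℕ := J + (if e.1 then V else 0) + e.2

/-- The gates of a template. -/
def instantiate (J V : ℕ) (l : List (Gate (Bool × ℕ))) : List (Gate ℕ) :=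
  l.map (Gate.map (refIndex J V))

/-- The lists `f (n - 1)`, …, `f 0`, joined together. -/
def blocks (f : ℕ → List (Gate ℕ)) : ℕ → List (Gate ℕ)
  | 0 => []
  | n + 1 => f n ++ blocks f n

theorem blocks_add (f : ℕ → List (Gate ℕ)) (k n : ℕ) :
    blocks f (k + n) = blocks (fun i => f (k + i)) n ++ blocks f k := by
  induction n with
  | zero => rfl
  | succ n ih => rw [← add_assoc, blocks, ih, blocks, List.append_assoc]

theorem blocks_congr {f g : ℕ → List (Gate ℕ)} {n : ℕ} (h : ∀ i < n, f i = g i) :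
    blocks f n = blocks g n := by
  induction n with
  | zero => rfl
  | succ n ih => rw [blocks, blocks, h n (by omega), ih fun i hi => h i (by omega)]

end Gate

namespace Prog

open StackCmd Gate

variable {I : Type}

theorem Run.of_eq {O : Type} {c : Prog I O} {s s' s'' : Store I O} {n n' : ℕ} (h : c.Run s s' n)
    (e : s' = s'') (hn : n ≤ n') : c.Run s s'' n' := e ▸ h.mono hn

/-- Write the unary digits of a counter. -/
def copyOut (c c' : Ctr) : Prog I CircuitSymbol :=
  .seq (whilePos c (.seq (inc c') (write .one))) (transfer c' c)

theorem run_copyOut {c c' : Ctr} (hc : c ≠ c') (s : Store I CircuitSymbol) (h0 : s.ctr c' = 0) :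
    (copyOut c c').Run s (s.setOut (List.replicate (s.ctr c) .one ++ s.out))
      (s.ctr c * 5 + 2) := by
  have h := run_whilePos (c := c) (p := (.seq (inc c') (write .one) : Prog I CircuitSymbol))
    (n := 2) (N := s.ctr c)
    (fun i => ((s.setOut (List.replicate i .one ++ s.out)).set c' i).set c (s.ctr c - i))
    (fun i _ => by simp) fun i hi => ?_
  · have e : ((s.setOut (List.replicate 0 .one ++ s.out)).set c' 0).set c (s.ctr c - 0) = s := by
      ext e <;> simp only [Store.set_ctr, Store.set_out, Store.set_inp, Store.setOut_out,
        Store.setOut_inp, Store.setOut_ctr]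
      · simp
      · split_ifs <;> simp_all
    rw [e] at h
    refine (h.seq (run_transfer hc.symm _)).of_eq ?_ ?_
    · ext d : 2 <;> simp
      by_cases h1 : d = c
      · subst h1
        simp [hc.symm, hc]
      · by_cases h2 : d = c' <;> simp_all
    · simp [hc.symm]
      omega
  · refine ((run_inc c' _).seq (run_write CircuitSymbol.one _)).of_eq ?_ le_rfl
    ext d : 2 <;> simp [List.replicate_succ]
    by_cases h1 : d = c <;> by_cases h2 : d = c' <;> simp_all

/-- Write the unary numeral for a reference. -/
def numeral (e : Bool × ℕ) : Prog I CircuitSymbol :=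
  .seq (write .mark) (.seq (copyOut .j .j')
    (.seq (if e.1 then copyOut .v .v' else .skip) (writes .one e.2)))

/-- The output is a stack, so text is produced from right to left: the end marker before the digits,
the name of a gate after its indices, later gates before earlier ones. This is also why `blocks`
lists its pieces in decreasing order. -/
theorem run_numeral (e : Bool × ℕ) (s : Store I CircuitSymbol) (hj : s.ctr .j' = 0)
    (hv : s.ctr .v' = 0) :
    (numeral e).Run s (s.setOut (unarySymbols (refIndex (s.ctr .j) (s.ctr .v) e) ++ s.out))
      (s.ctr .j * 5 + s.ctr .v * 5 + e.2 + 6) := by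
  have h1 := run_write .mark s
  have h2 := run_copyOut (c := .j) (c' := .j') (by decide) (s.setOut (.mark :: s.out)) hj
  obtain ⟨b, n⟩ := e
  have key : ∀ l k : ℕ, List.replicate l CircuitSymbol.one ++ (unarySymbols k ++ s.out) =
      unarySymbols (l + k) ++ s.out := by
    intro l k
    rw [unarySymbols, unarySymbols, List.replicate_add]
    simp only [List.append_assoc]
  have key' : ∀ k : ℕ, List.replicate k CircuitSymbol.one ++ CircuitSymbol.mark :: s.out =
      unarySymbols k ++ s.out := by
    intro k
    rw [unarySymbols]
    simp
  rcases b with _ | _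
  · refine (h1.seq (h2.seq ((run_skip _).seq (run_writes .one n _)))).of_eq ?_ ?_
    · simp only [Store.setOut, key', key, refIndex, Bool.false_eq_true, if_false, add_zero]
      rw [add_comm]
    · simp
      omega
  · have h3 := run_copyOut (c := .v) (c' := .v') (by decide)
      (s.setOut (unarySymbols (s.ctr .j) ++ s.out)) hv
    rw [Store.setOut_ctr, Store.setOut_out, key', Store.setOut] at h2
    refine (h1.seq (h2.seq (h3.seq (run_writes .one n _)))).of_eq ?_ ?_
    · simp only [Store.setOut, key, refIndex, if_true]
      rw [add_comm n, add_comm (s.ctr .v)]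
    · simp
      omega

/-- Write a gate of a template. -/
def emitGate : Gate (Bool × ℕ) → Prog I CircuitSymbol
  | .S e => .seq (numeral e) (write .S)
  | .T e => .seq (numeral e) (write .T)
  | .CZ e e' => .seq (.seq (numeral e') (numeral e)) (write .CZ)

theorem exists_run_emitGate (g : Gate (Bool × ℕ)) : ∃ κ : ℕ, ∀ s : Store I CircuitSymbol,
    s.ctr .j' = 0 → s.ctr .v' = 0 →
    (emitGate g).Run s
      (s.setOut ((g.map (refIndex (s.ctr .j) (s.ctr .v))).symbols ++ s.out))
      (κ * (s.ctr .j + s.ctr .v + 1)) := by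
  rcases g with e | e | ⟨e, e'⟩
  · refine ⟨e.2 + 7, fun s hj hv => ?_⟩
    refine Run.mono ((run_numeral e s hj hv).seq (run_write _ _)) ?_
    nlinarith
  · refine ⟨e.2 + 7, fun s hj hv => ?_⟩
    refine Run.mono ((run_numeral e s hj hv).seq (run_write _ _)) ?_
    nlinarith
  · refine ⟨e.2 + e'.2 + 13, fun s hj hv => ?_⟩
    refine (((run_numeral e' s hj hv).seq (run_numeral e _ hj hv)).seq
      (run_write CircuitSymbol.CZ _)).of_eq ?_ ?_
    · simp [Store.setOut, Gate.symbols, Gate.map]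
    · simp only [Store.setOut_ctr]
      nlinarith

/-- Write the gates of a template. -/
def emitGates : List (Gate (Bool × ℕ)) → Prog I CircuitSymbol
  | [] => .skip
  | g :: l => .seq (emitGates l) (emitGate g)

theorem exists_run_emitGates (l : List (Gate (Bool × ℕ))) :
    ∃ κ : ℕ, ∀ s : Store I CircuitSymbol, s.ctr .j' = 0 → s.ctr .v' = 0 →
    (emitGates l).Run s
      (s.setOut ((instantiate (s.ctr .j) (s.ctr .v) l).flatMap Gate.symbols ++ s.out))
      (κ * (s.ctr .j + s.ctr .v + 1)) := by
  induction l with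
  | nil => exact ⟨1, fun s _ _ => (run_skip s).mono (by omega)⟩
  | cons g l ih =>
    obtain ⟨κ, h⟩ := ih
    obtain ⟨κ', h'⟩ := exists_run_emitGate (I := I) g
    refine ⟨κ + κ', fun s hj hv => ?_⟩
    rw [add_mul]
    refine ((h s hj hv).seq (h' _ hj hv)).of_eq ?_ le_rfl
    simp [Store.setOut, instantiate]

/-- A store in which only some counters are used. -/
def store (inp : List I) (out : List CircuitSymbol) (x a j v : ℕ) : Store I CircuitSymbol :=
  ⟨inp, out, fun
    | .x => x
    | .a => a
    | .j => j
    | .v => v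
    | _ => 0⟩

/-- Write the gates of a template several times. -/
def emitLoop (l : List (Gate (Bool × ℕ))) (B : ℕ) : Prog I CircuitSymbol :=
  whilePos .a (.seq (emitGates l) (incs .j B))

theorem run_emitLoop {l : List (Gate (Bool × ℕ))} (B : ℕ) {κ : ℕ}
    (h : ∀ s : Store I CircuitSymbol, s.ctr .j' = 0 → s.ctr .v' = 0 →
    (emitGates l).Run s
      (s.setOut ((instantiate (s.ctr .j) (s.ctr .v) l).flatMap Gate.symbols ++ s.out))
      (κ * (s.ctr .j + s.ctr .v + 1)))
    (inp : List I) (out : List CircuitSymbol) (x N j v : ℕ) :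
    (emitLoop l B).Run (store inp out x N j v)
      (store inp ((blocks (fun i => instantiate (j + B * i) v l) N).flatMap Gate.symbols ++ out)
        x 0 (j + B * N) v) (N * (κ * (j + B * N + v + 1) + (B + 1) + 1) + 1) := by
  have hw := run_whilePos (c := .a) (p := (.seq (emitGates l) (incs .j B) : Prog I CircuitSymbol))
    (n := κ * (j + B * N + v + 1) + (B + 1)) (N := N)
    (fun i => store inp ((blocks (fun i => instantiate (j + B * i) v l) i).flatMap Gate.symbols
      ++ out) x (N - i) (j + B * i) v) (fun i _ => rfl) fun i hi => ?_
  · simpa [blocks, emitLoop] using hw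
  · refine ((h ((store inp _ x (N - i) (j + B * i) v).set .a (N - (i + 1))) rfl rfl).seq
      (run_incs .j B _)).of_eq ?_ ?_
    · ext d : 2
      · rfl
      · simp [store, blocks]
      · cases d <;> simp [store]
        ring
    · have : B * i ≤ B * N := Nat.mul_le_mul_left _ hi.le
      simp only [store, Store.set_ctr, reduceCtorEq, if_false]
      gcongr

/-- The gates which belong to cell `i`: the first cells are initialized; the others are determined
by the template `tt`. -/
def cellGates (B : ℕ) (t₀ t₁ ty te tt : List (Gate (Bool × ℕ)))
    (tx : Bool → List (Gate (Bool × ℕ))) (x : List Bool) (P E : ℕ) : ℕ → List (Gate ℕ)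
  | 0 => instantiate 0 0 t₀
  | 1 => instantiate 0 0 t₁
  | i + 2 =>
    if h : i < x.length then instantiate (B * i) 0 (tx x[i])
    else if i < x.length + P then instantiate (B * i) 0 ty
    else if i < x.length + P + E then instantiate (B * i) 0 te
    else instantiate (B * (i - (x.length + P + E))) (B * (x.length + P + E)) tt

theorem exists_run_circuit (B : ℕ) (t₀ t₁ ty te tt : List (Gate (Bool × ℕ)))
    (tx : Bool → List (Gate (Bool × ℕ))) (p E Q : Polynomial ℕ) :
    ∃ (c : Prog Bool CircuitSymbol) (T : Polynomial ℕ), ∀ x : List Bool,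
      c.Run ⟨x, [], fun _ => 0⟩
        ⟨[], unarySymbols (B * (x.length + p.eval x.length + E.eval x.length + Q.eval x.length + 2))
          ++ (blocks (cellGates B t₀ t₁ ty te tt tx x (p.eval x.length) (E.eval x.length))
            (x.length + p.eval x.length + E.eval x.length + Q.eval x.length + 2)).flatMap
              Gate.symbols, fun _ => 0⟩
        (T.eval x.length) := by
  obtain ⟨κ₀, h₀⟩ := exists_run_emitGates (I := Bool) t₀
  obtain ⟨κ₁, h₁⟩ := exists_run_emitGates (I := Bool) t₁
  obtain ⟨κy, hy⟩ := exists_run_emitGates (I := Bool) ty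
  obtain ⟨κe, he⟩ := exists_run_emitGates (I := Bool) te
  obtain ⟨κt, ht⟩ := exists_run_emitGates (I := Bool) tt
  obtain ⟨κx, hx⟩ := Classical.axiomOfChoice fun b => exists_run_emitGates (I := Bool) (tx b)
  obtain ⟨cp, Tp, hp⟩ := exists_run_eval p
  obtain ⟨cE, TE, hE⟩ := exists_run_eval E
  obtain ⟨cQ, TQ, hQ⟩ := exists_run_eval Q
  let X : Polynomial ℕ := Polynomial.X
  let K : Polynomial ℕ := Polynomial.C (κx true + κx false)
  let b : Polynomial ℕ := Polynomial.C B
  refine ⟨.seq (emitGates t₀) <| .seq (emitGates t₁) <|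
    .seq (forInput fun b => .seq (emitGates (tx b)) (.seq (incs .j B) (inc .x))) <|
    .seq (cp _ _) <| .seq (emitLoop ty B) <| .seq (cE _ _) <| .seq (emitLoop te B) <|
    -- From here on `v` holds the distance B · (|x| + P + E) between a cell and the one it is
    -- computed from, and `j` restarts at 0 to address the earlier row.
    .seq (transfer .j .v) <| .seq (cQ _ _) <| .seq (emitLoop tt B) <|
    -- Now `j` is B · Q, so the reference evaluates to j + v + 2B, the number of qubits. It is
    -- written last because it must stand first in the text.
    .seq (numeral (true, 2 * B)) <| .seq (clear .x) <| .seq (clear .j) (clear .v),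
    Polynomial.C κ₀ + (Polynomial.C κ₁ +
      ((X * (K * (b * X + 1) + (b + 1 + 1) + 1) + 1) +
      (Tp + ((p * (Polynomial.C κy * (b * (X + p) + 0 + 1) + (b + 1) + 1) + 1) +
      (TE + ((E * (Polynomial.C κe * (b * (X + p + E) + 0 + 1) + (b + 1) + 1) + 1) +
      ((b * (X + p + E) * 2 + 1) +
      (TQ + ((Q * (Polynomial.C κt * (0 + b * Q + b * (X + p + E) + 1) + (b + 1) + 1) + 1) +
      ((b * Q * 5 + b * (X + p + E) * 5 + 2 * b + 6) +
      ((X * 2 + 1) + ((b * Q * 2 + 1) + (b * (X + p + E) * 2 + 1))))))))))))),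
    fun x => ?_⟩
  set n := x.length with hn
  set P := p.eval n with hP
  set E' := E.eval n with hE'
  set Q' := Q.eval n with hQ'
  set f := cellGates B t₀ t₁ ty te tt tx x P E' with hf
  let o (k : ℕ) : List CircuitSymbol := (blocks f k).flatMap Gate.symbols
  have ho : ∀ k N (g : ℕ → List (Gate ℕ)), (∀ i < N, f (k + i) = g i) →
      (blocks g N).flatMap Gate.symbols ++ o k = o (k + N) := by
    intro k N g hg
    simp only [o]
    rw [blocks_add, List.flatMap_append, blocks_congr hg]
  have s0 : (emitGates t₀).Run (store x [] 0 0 0 0) (store x (o 1) 0 0 0 0) κ₀ := by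
    convert h₀ (store x [] 0 0 0 0) rfl rfl using 1
    · ext d
      · rfl
      · simp [store, o, blocks, hf, cellGates]
      · rfl
    · simp [store]
  have s1 : (emitGates t₁).Run (store x (o 1) 0 0 0 0) (store x (o 2) 0 0 0 0) κ₁ := by
    convert h₁ (store x (o 1) 0 0 0 0) rfl rfl using 1
    · ext d
      · rfl
      · simp [store, o, blocks, hf, cellGates]
      · rfl
    · simp [store]
  have s2 : (forInput fun b => .seq (emitGates (tx b)) (.seq (incs .j B) (inc .x))).Run
      (store x (o 2) 0 0 0 0) (store [] (o (2 + n)) n 0 (B * n) 0)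
      (n * ((κx true + κx false) * (B * n + 1) + (B + 1 + 1) + 1) + 1) := by
    have := run_forInput (p := fun b => .seq (emitGates (tx b)) (.seq (incs .j B) (inc .x)))
      (n := (κx true + κx false) * (B * n + 1) + (B + 1 + 1)) x
      (fun i => store (x.drop i) (o (2 + i)) i 0 (B * i) 0) (fun i _ => rfl) fun i hi => ?_
    · simp only [List.drop_length, mul_zero, List.drop_zero] at this
      exact this
    · refine Run.mono (n := κx x[i] * (B * i + 0 + 1) + (B + 1 + 1)) ?_ ?_
      · refine ((hx x[i] ((store (x.drop i) (o (2 + i)) i 0 (B * i) 0).setInp (x.drop (i + 1)))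
          rfl rfl).seq ((run_incs .j B _).seq (run_inc .x _))).of_eq ?_ le_rfl
        · ext d : 2
          · rfl
          · have e : f (2 + i) = instantiate (B * i) 0 (tx x[i]) := by
              rw [add_comm]
              simp [hf, cellGates, hi]
            simp [store, o, blocks, ← add_assoc, e]
          · cases d <;> simp [store]
            ring
      · have h1 : κx x[i] ≤ κx true + κx false := by
          cases x[i] <;> omega
        have h2 : B * i ≤ B * n := Nat.mul_le_mul_left _ hi.le
        rw [add_zero]
        gcongr
  have sp : (cp _ _).Run (store [] (o (2 + n)) n 0 (B * n) 0)
      (store ([] : List Bool) (o (2 + n)) n P (B * n) 0) (Tp.eval n) := by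
    refine (hp _ _ (store [] (o (2 + n)) n 0 (B * n) 0) rfl rfl rfl).of_eq ?_ le_rfl
    ext d : 2
    · rfl
    · rfl
    · cases d <;> simp [store, hP]
  have sy := run_emitLoop B hy [] (o (2 + n)) n P (B * n) 0
  rw [ho (2 + n) P _ fun i hi => ?_] at sy
  swap
  · rw [show 2 + n + i = n + i + 2 by ring]
    simp [hf, cellGates, ← hn, hi, Nat.mul_add]
  rw [← Nat.mul_add] at sy
  have sE : (cE _ _).Run (store [] (o (2 + n + P)) n 0 (B * (n + P)) 0)
      (store ([] : List Bool) (o (2 + n + P)) n E' (B * (n + P)) 0) (TE.eval n) := by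
    refine (hE _ _ (store [] (o (2 + n + P)) n 0 (B * (n + P)) 0) rfl rfl rfl).of_eq ?_ le_rfl
    ext d : 2
    · rfl
    · rfl
    · cases d <;> simp [store, hE']
  have se := run_emitLoop B he [] (o (2 + n + P)) n E' (B * (n + P)) 0
  rw [ho (2 + n + P) E' _ fun i hi => ?_] at se
  swap
  · rw [show 2 + n + P + i = n + P + i + 2 by ring]
    simp [hf, cellGates, ← hn, hi, Nat.mul_add, add_assoc]
  rw [← Nat.mul_add] at se
  have st : (transfer .j .v).Run (store [] (o (2 + n + P + E')) n 0 (B * (n + P + E')) 0)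
      (store ([] : List Bool) (o (2 + n + P + E')) n 0 0 (B * (n + P + E')))
      (B * (n + P + E') * 2 + 1) := by
    refine (run_transfer (c := .j) (d := .v) (by decide)
      (store [] (o (2 + n + P + E')) n 0 (B * (n + P + E')) 0)).of_eq ?_ le_rfl
    ext d : 2
    · rfl
    · rfl
    · cases d <;> simp [store]
  have sQ : (cQ _ _).Run (store [] (o (2 + n + P + E')) n 0 0 (B * (n + P + E')))
      (store ([] : List Bool) (o (2 + n + P + E')) n Q' 0 (B * (n + P + E'))) (TQ.eval n) := by
    refine (hQ _ _ (store [] (o (2 + n + P + E')) n 0 0 (B * (n + P + E'))) rfl rfl rfl).of_eq ?_ le_rfl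
    ext d : 2
    · rfl
    · rfl
    · cases d <;> simp [store, hQ']
  have stt := run_emitLoop B ht [] (o (2 + n + P + E')) n Q' 0 (B * (n + P + E'))
  rw [ho (2 + n + P + E') Q' _ fun i hi => ?_] at stt
  swap
  · rw [show 2 + n + P + E' + i = n + P + E' + i + 2 by ring]
    have e : n + P + E' + i - (n + P + E') = i := by omega
    simp only [hf, cellGates, ← hn, e, zero_add]
    rw [dif_neg (by omega), if_neg (by omega), if_neg (by omega)]
  have e1 : 2 + n + P + E' + Q' = n + P + E' + Q' + 2 := by ring
  rw [e1, zero_add] at stt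
  have sn := run_numeral (true, 2 * B) (store ([] : List Bool) (o (n + P + E' + Q' + 2)) n 0
    (B * Q') (B * (n + P + E'))) rfl rfl
  have sc := (run_clear .x ((store ([] : List Bool) (o (n + P + E' + Q' + 2)) n 0
    (B * Q') (B * (n + P + E'))).setOut (unarySymbols (refIndex (B * Q') (B * (n + P + E'))
      (true, 2 * B)) ++ o (n + P + E' + Q' + 2)))).seq ((run_clear .j _).seq (run_clear .v _))
  have e0 : (⟨x, [], fun _ => 0⟩ : Store Bool CircuitSymbol) = store x [] 0 0 0 0 := by
    ext d : 2
    · rfl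
    · rfl
    · cases d <;> rfl
  rw [e0]
  refine (s0.seq (s1.seq (s2.seq (sp.seq (sy.seq (sE.seq (se.seq (st.seq (sQ.seq (stt.seq
    (sn.seq sc))))))))))).of_eq ?_ ?_
  · ext d : 2
    · rfl
    · have e2 : refIndex (B * Q') (B * (n + P + E')) (true, 2 * B) =
          B * (n + P + E' + Q' + 2) := by
        simp only [refIndex, if_true]
        ring
      simp [e2, o]
    · cases d <;> simp [store]
  · simp [X, K, b, store, ← hP, ← hE', ← hQ']

end Prog

end

noncomputable section

/-! ### The program which reads off the answer -/

/-- Bit lengths can be found by counting input symbols, without any binary arithmetic. -/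
theorem length_encodeNat (n : ℕ) : (encodeNat n).length = Nat.size n := by
  have h : ∀ k : PosNum, (encodePosNum k).length = k.natSize := by
    intro k
    induction k with
    | one => rfl
    | bit0 k ih => simp [encodePosNum, PosNum.natSize, ih]
    | bit1 k ih => simp [encodePosNum, PosNum.natSize, ih]
  have h' : ∀ k : Num, (encodeNum k).length = k.natSize := by
    rintro (_ | k)
    · rfl
    · exact h k
  rw [encodeNat, h', Num.natSize_to_nat, Num.to_of_nat]

theorem Polynomial.eval_mono_nat (p : Polynomial ℕ) {m n : ℕ} (h : m ≤ n) :
    p.eval m ≤ p.eval n := by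
  rw [Polynomial.eval_eq_sum_range, Polynomial.eval_eq_sum_range]
  gcongr

/-- `v` is positive and not much smaller than `2⁻ⁿ`, judging by the lengths of the numerator and the
denominator. -/
def exceedsThreshold (n : ℕ) (v : ℚ) : Bool :=
  decide (0 < v.num ∧ Nat.size v.den ≤ n + Nat.size v.num.natAbs)

namespace Prog

open StackCmd

/-- The alphabet for pairs of a string and a rational number. -/
abbrev PairSymbol : Type := Bool ⊕ (Bool ⊕ Bool)

/-- The symbols of the string. -/
def stringPart (l : List PairSymbol) : List Bool := l.filterMap fun
  | .inl b => some b
  | _ => none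

/-- The symbols of the numerator. -/
def numPart (l : List PairSymbol) : List Bool := l.filterMap fun
  | .inr (.inl b) => some b
  | _ => none

/-- The symbols of the denominator. -/
def denPart (l : List PairSymbol) : List Bool := l.filterMap fun
  | .inr (.inr b) => some b
  | _ => none

/-- A store in which only some counters are used. -/
def readStore (inp : List PairSymbol) (out : List Bool) (x a j v d : ℕ) :
    Store PairSymbol Bool :=
  ⟨inp, out, fun
    | .x => x
    | .a => a
    | .j => j
    | .v => v
    | .v' => d
    | _ => 0⟩

/-- Count the symbols of the three parts of the input, and remember the sign. -/
def readSymbol : PairSymbol → Prog PairSymbol Bool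
  | .inl _ => inc .x
  -- `j = 0` identifies the first symbol, which is the sign. In the other case `test` has removed
  -- one unit from `j`, so 2 is added.
  | .inr (.inl b) => test .j (.seq (if b then inc .v else .skip) (inc .j)) (incs .j 2)
  | .inr (.inr _) => inc .v'

theorem run_read (l : List PairSymbol) :
    (forInput readSymbol).Run (readStore l [] 0 0 0 0 0)
      (readStore [] [] (stringPart l).length 0 (numPart l).length
        (if (numPart l).head? = some true then 1 else 0) (denPart l).length)
      (l.length * (4 + 1) + 1) := by
  have h := run_forInput (p := readSymbol) (n := 4) l
    (fun i => readStore (l.drop i) [] (stringPart (l.take i)).length 0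
      (numPart (l.take i)).length (if (numPart (l.take i)).head? = some true then 1 else 0)
      (denPart (l.take i)).length) (fun i _ => rfl) fun i hi => ?_
  · simpa [stringPart, numPart, denPart] using h
  · rw [List.take_succ_eq_append_getElem hi]
    rcases l[i] with b | b | b
    · refine (run_inc .x _).of_eq ?_ (by omega)
      ext c : 2
      · rfl
      · rfl
      · cases c <;> simp [readStore, stringPart, numPart, denPart]
    · rcases hn : numPart (l.take i) with _ | ⟨c, t⟩
      · refine run_test_zero ?_ ?_
        · simp [readStore]
        · cases b
          · refine ((run_skip _).seq (run_inc .j _)).of_eq (n := 2) ?_ (by omega)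
            ext c : 2
            · rfl
            · rfl
            · simp only [numPart] at hn
              cases c <;> simp [readStore, stringPart, numPart, denPart, hn]
          · refine ((run_inc .v _).seq (run_inc .j _)).of_eq (n := 2) ?_ (by omega)
            ext c : 2
            · rfl
            · rfl
            · simp only [numPart] at hn
              cases c <;> simp [readStore, stringPart, numPart, denPart, hn]
      · refine run_test_succ (k := t.length) ?_ ?_
        · simp [readStore]
        · refine (run_incs .j 2 _).of_eq ?_ le_rfl
          ext c : 2
          · rfl
          · rfl
          · simp only [numPart] at hn
            cases c <;> simp [readStore, stringPart, numPart, denPart, hn]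
    · refine (run_inc .v' _).of_eq ?_ (by omega)
      ext c : 2
      · rfl
      · rfl
      · cases c <;> simp [readStore, stringPart, numPart, denPart]

/-- `a` and `d` are decreased together, and `v` collects the excess of `d` over `a`. -/
theorem run_compare (x a v d : ℕ) :
    (whilePos .v' (test .a (inc .v) .skip)).Run (readStore [] [] x a 0 v d)
      (readStore [] [] x (a - d) 0 (v + (d - a)) 0) (d * (2 + 1) + 1) := by
  have h := run_whilePos (c := .v')
    (p := (test .a (inc .v) .skip : Prog PairSymbol Bool)) (n := 2) (N := d)
    (fun i => readStore [] [] x (a - i) 0 (v + (i - a)) (d - i)) (fun i _ => rfl) fun i hi => ?_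
  · simpa using h
  · rcases Nat.lt_or_ge i a with hia | hia
    · refine run_test_succ (k := a - (i + 1)) ?_ ((run_skip _).of_eq ?_ le_rfl)
      · simp [readStore]
        omega
      · ext c : 2
        · rfl
        · rfl
        · cases c <;> simp [readStore]
          omega
    · refine run_test_zero ?_ ((run_inc _ _).of_eq ?_ le_rfl)
      · simp [readStore]
        omega
      · ext c : 2
        · rfl
        · rfl
        · cases c <;> simp [readStore]
          · omega
          · omega

theorem exists_run_threshold (N : Polynomial ℕ) :
    ∃ (c : Prog PairSymbol Bool) (T : Polynomial ℕ), ∀ (l : List PairSymbol) (s : Bool)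
      (num : List Bool), numPart l = s :: num →
      c.Run ⟨l, [], fun _ => 0⟩
        ⟨[], [decide (s = false ∧ num ≠ [] ∧
          (denPart l).length ≤ N.eval (stringPart l).length + num.length)], fun _ => 0⟩
        (T.eval l.length) := by
  obtain ⟨cN, TN, hN⟩ := exists_run_eval N
  refine ⟨.seq (forInput readSymbol) <| .seq (cN _ _) <| .seq (test .j .skip .skip) <|
    .seq (.seq (test .j (inc .v) (inc .a)) (transfer .j .a)) <|
    .seq (whilePos .v' (test .a (inc .v) .skip)) <|
    .seq (test .v (write true) (write false)) <| .seq (clear .x) <| .seq (clear .a) (clear .v),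
    (Polynomial.X * (4 + 1) + 1) + (TN + (2 + (2 + ((Polynomial.X * 2 + 1) +
      ((Polynomial.X * (2 + 1) + 1) + (2 + ((Polynomial.X * 2 + 1) +
      (((N + Polynomial.X) * 2 + 1) + ((2 + Polynomial.X) * 2 + 1))))))))), ?_⟩
  intro l s num hl
  set x := (stringPart l).length with hx
  set d := (denPart l).length with hd
  set L := l.length with hL
  have hxL : x ≤ L := List.length_filterMap_le _ _
  have hdL : d ≤ L := List.length_filterMap_le _ _
  have hnL : num.length ≤ L := by
    have : (numPart l).length ≤ L := List.length_filterMap_le _ _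
    rw [hl, List.length_cons] at this
    omega
  set v₀ := if s = true then 1 else 0 with hv₀
  -- The counter `v` accumulates reasons to reject: a negative sign, a zero numerator (empty code),
  -- and finally a denominator that is too long. The answer is yes exactly if it stays 0.
  set v₁ := v₀ + if num = [] then 1 else 0 with hv₁
  set A := N.eval x + num.length with hA
  have h1 := run_read l
  rw [hl] at h1
  simp only [List.head?_cons, Option.some.injEq, List.length_cons, ← hv₀, ← hx, ← hd, ← hL] at h1
  have h2 : (cN _ _).Run (readStore [] [] x 0 (num.length + 1) v₀ d)
      (readStore [] [] x (N.eval x) (num.length + 1) v₀ d) (TN.eval x) := by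
    refine (hN _ _ (readStore [] [] x 0 (num.length + 1) v₀ d) rfl rfl rfl).of_eq ?_ le_rfl
    ext c : 2
    · rfl
    · rfl
    · cases c <;> simp [readStore]
  have h3 : (test .j .skip .skip).Run (readStore [] [] x (N.eval x) (num.length + 1) v₀ d)
      (readStore [] [] x (N.eval x) num.length v₀ d) 2 := by
    refine run_test_succ (k := num.length) rfl ((run_skip _).of_eq ?_ le_rfl)
    ext c : 2
    · rfl
    · rfl
    · cases c <;> simp [readStore]
  have h4 : Prog.Run (.seq (test .j (inc .v) (inc .a)) (transfer .j .a))
      (readStore [] [] x (N.eval x) num.length v₀ d) (readStore [] [] x A 0 v₁ d)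
      (2 + (num.length * 2 + 1)) := by
    rcases num with _ | ⟨b, num⟩
    · have := run_test_zero (c := .j) (q := inc .a)
        (s := readStore [] [] x (N.eval x) 0 v₀ d) rfl (run_inc .v _)
      refine (this.seq (run_transfer (c := .j) (d := .a) (by decide) _)).of_eq ?_ ?_
      · ext c : 2
        · rfl
        · rfl
        · cases c <;> simp [readStore, hA, hv₁]
      · simp [readStore]
    · have := run_test_succ (c := .j) (p := inc .v) (k := num.length)
        (s := readStore [] [] x (N.eval x) (num.length + 1) v₀ d) rfl (run_inc .a _)
      refine (this.seq (run_transfer (c := .j) (d := .a) (by decide) _)).of_eq ?_ ?_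
      · ext c : 2
        · rfl
        · rfl
        · cases c <;> simp [readStore, hA, hv₁]
          omega
      · simp [readStore]
  have h5 := run_compare x A v₁ d
  set w := v₁ + (d - A) with hw
  have h6 : (test .v (write true) (write false)).Run (readStore [] [] x (A - d) 0 w 0)
      (readStore [] [decide (w = 0)] x (A - d) 0 (w - 1) 0) 2 := by
    rcases hw' : w with _ | k
    · refine run_test_zero rfl ((run_write _ _).of_eq ?_ le_rfl)
      rfl
    · refine run_test_succ (k := k) rfl ((run_write _ _).of_eq ?_ le_rfl)
      ext c : 2
      · rfl
      · simp [readStore]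
      · cases c <;> simp [readStore]
  have h7 := (run_clear .x (readStore [] [decide (w = 0)] x (A - d) 0 (w - 1) 0)).seq
    ((run_clear .a _).seq (run_clear .v _))
  have e0 : (⟨l, [], fun _ => 0⟩ : Store PairSymbol Bool) = readStore l [] 0 0 0 0 0 := by
    ext c : 2
    · rfl
    · rfl
    · cases c <;> rfl
  rw [e0]
  refine (h1.seq (h2.seq (h3.seq (h4.seq (h5.seq (h6.seq h7)))))).of_eq ?_ ?_
  · ext c : 2
    · rfl
    · have hw0 : w = 0 ↔ (s = false ∧ num ≠ [] ∧ d ≤ A) := by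
        rw [hw, hv₁, hv₀]
        rcases s <;> rcases num with _ | ⟨b, num⟩ <;> simp [Nat.sub_eq_zero_iff_le]
      simp [readStore, hw0]
    · cases c <;> simp [readStore]
  · have t1 := Polynomial.eval_mono_nat TN hxL
    have t2 := Polynomial.eval_mono_nat N hxL
    have t3 : v₁ ≤ 2 := by
      rw [hv₁, hv₀]
      split_ifs <;> omega
    simp [readStore]
    omega

theorem polyTime {I O α β : Type} [Fintype I] [Fintype O] {ea : Encoding α I} {eb : Encoding β O}
    {f : α → β} (c : Prog I O) (T : Polynomial ℕ)
    (h : ∀ a, c.Run ⟨ea.encode a, [], fun _ => 0⟩ ⟨[], eb.encode (f a), fun _ => 0⟩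
      (T.eval (ea.encode a).length)) : PolyTime ea eb f := by
  refine StackCmd.polyTime c .inp .out (Equiv.refl I) (Equiv.refl O) T fun a => ?_
  obtain ⟨t, ht, hc⟩ := h a
  refine ⟨t, ht, ?_⟩
  convert hc using 1
  · funext k
    cases k <;> simp [Store.stk]
  · funext k
    cases k <;> simp [Store.stk]

theorem polyTime_exceedsThreshold (N : Polynomial ℕ) :
    PolyTime (encodingProd (encodingList Bool) encodingRat) encodingBoolBool
      (fun q => exceedsThreshold (N.eval q.1.length) q.2) := by
  obtain ⟨c, T, h⟩ := exists_run_threshold N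
  refine polyTime c T fun q => ?_
  obtain ⟨x, v⟩ := q
  have e : (encodingProd (encodingList Bool) encodingRat).encode (x, v) =
      x.map Sum.inl ++ (((decide (v.num < 0) :: encodeNat v.num.natAbs).map Sum.inl ++
        (encodeNat v.den).map Sum.inr).map Sum.inr) := rfl
  have h1 : stringPart ((encodingProd (encodingList Bool) encodingRat).encode (x, v)) = x := by
    rw [e]
    simp [stringPart, List.filterMap_append, List.filterMap_map, Function.comp_def]
  have h2 : numPart ((encodingProd (encodingList Bool) encodingRat).encode (x, v)) =
      decide (v.num < 0) :: encodeNat v.num.natAbs := by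
    rw [e]
    simp [numPart, List.filterMap_append, List.filterMap_map, Function.comp_def]
  have h3 : denPart ((encodingProd (encodingList Bool) encodingRat).encode (x, v)) =
      encodeNat v.den := by
    rw [e]
    simp [denPart, List.filterMap_append, List.filterMap_map, Function.comp_def]
  refine (h _ _ _ h2).of_eq ?_ le_rfl
  have h4 : encodeNat v.num.natAbs ≠ [] ↔ v.num ≠ 0 := by
    rw [ne_eq, ← List.length_eq_zero_iff, length_encodeNat, Nat.size_eq_zero, Int.natAbs_eq_zero]
  have h5 : decide (decide (v.num < 0) = false ∧ encodeNat v.num.natAbs ≠ [] ∧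
      (encodeNat v.den).length ≤ N.eval x.length + (encodeNat v.num.natAbs).length) =
      exceedsThreshold (N.eval x.length) v := by
    rw [exceedsThreshold, decide_eq_decide, h4, length_encodeNat, length_encodeNat,
      decide_eq_false_iff_not, not_lt, ← and_assoc, lt_iff_le_and_ne, ne_comm]
  rw [h1, h3, h5]
  rfl

end Prog

/-- If M = 0 and v > 0, then num · 2^(2n+1) ≤ den, so the denominator is longer than the numerator
by at least 2n + 1 bits. If M ≥ 2, then v ≥ (2 - 1/2) · 4⁻ⁿ ≥ 4⁻ⁿ, so den ≤ num · 2^(2n) and the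
difference is at most 2n bits. The gap is wide enough for bit lengths to decide. -/
theorem exceedsThreshold_iff {n : ℕ} {v : ℚ} {M : ℝ} (hM : M = 0 ∨ 2 ≤ M)
    (hv : |(v : ℝ) - M / 4 ^ n| ≤ 1 / 2 ^ (2 * n + 1)) :
    exceedsThreshold (2 * n) v = true ↔ M ≠ 0 := by
  have hd : (0 : ℝ) < v.den := by exact_mod_cast v.den_pos
  have hvd : (v : ℝ) = v.num / v.den := by exact_mod_cast (Rat.num_div_den v).symm
  have h4 : (4 : ℝ) ^ n = 2 ^ (2 * n) := by rw [pow_mul]; norm_num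
  have hp : (0 : ℝ) < 2 ^ (2 * n) := by positivity
  rw [h4, pow_succ, hvd, abs_le] at hv
  rw [exceedsThreshold, decide_eq_true_iff]
  constructor
  · rintro ⟨hpos, hs⟩ rfl
    have h1 : (v.num : ℝ) * (2 ^ (2 * n) * 2) ≤ v.den := by
      have := hv.2
      rw [zero_div, sub_zero, div_le_div_iff₀ hd (by positivity), one_mul] at this
      exact this
    have h2 : v.num.natAbs * 2 ^ (2 * n + 1) ≤ v.den := by
      have h3 : (v.num.natAbs : ℝ) = v.num := by
        rw [Nat.cast_natAbs, abs_of_pos hpos]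
      rw [pow_succ]
      rw [← h3] at h1
      exact_mod_cast h1
    have h5 : 0 < v.num.natAbs.size := Nat.size_pos.2 (Int.natAbs_pos.2 hpos.ne')
    have h6 : 2 ^ (v.num.natAbs.size - 1) ≤ v.num.natAbs := Nat.lt_size.1 (by omega)
    have h7 : 2 ^ (v.num.natAbs.size - 1 + (2 * n + 1)) ≤ v.den := by
      rw [pow_add]
      exact (Nat.mul_le_mul_right _ h6).trans h2
    have := Nat.lt_size.2 h7
    omega
  · intro h0
    have hM2 := hM.resolve_left h0
    have h1 : 1 / 2 ^ (2 * n) ≤ (v.num : ℝ) / v.den := by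
      have h2 := hv.1
      have h3 : 2 / 2 ^ (2 * n) ≤ M / 2 ^ (2 * n) := by gcongr
      have h5 : (1 : ℝ) / (2 ^ (2 * n) * 2) = 1 / 2 ^ (2 * n) / 2 := by rw [div_div]
      have h6 : (2 : ℝ) / 2 ^ (2 * n) = 2 * (1 / 2 ^ (2 * n)) := by ring
      have h7 : (0 : ℝ) < 1 / 2 ^ (2 * n) := by positivity
      linarith
    rw [div_le_div_iff₀ hp hd, one_mul] at h1
    have hpos : 0 < v.num := by
      have : (0 : ℝ) < v.num := (mul_pos_iff_of_pos_right hp).1 (hd.trans_le h1)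
      exact_mod_cast this
    refine ⟨hpos, Nat.size_le.2 ?_⟩
    have h2 : v.den ≤ v.num.natAbs * 2 ^ (2 * n) := by
      have h3 : (v.num.natAbs : ℝ) = v.num := by
        rw [Nat.cast_natAbs, abs_of_pos hpos]
      rw [← h3] at h1
      exact_mod_cast h1
    rw [pow_add, mul_comm]
    exact h2.trans_lt (Nat.mul_lt_mul_of_pos_right (Nat.lt_size_self _) (by positivity))

end

noncomputable section

/-! ### Output probabilities as sums of phases -/

open Gate

theorem hadamardAll_zero_left {n : ℕ} (z : Fin n → Bool) :
    hadamardAll n (fun _ => false) z = (1 / (Real.sqrt 2 : ℂ)) ^ n := by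
  simp [hadamardAll, hadamardGate]

theorem hadamardAll_zero_right {n : ℕ} (z : Fin n → Bool) :
    hadamardAll n z (fun _ => false) = (1 / (Real.sqrt 2 : ℂ)) ^ n := by
  simp [hadamardAll, hadamardGate]

theorem prod_toMatrix {n : ℕ} (C : IQPCircuit n) :
    (C.map DiagonalGate.toMatrix).prod =
      Matrix.diagonal fun z => (C.map fun G => (G.phase z : ℂ)).prod := by
  induction C with
  | nil => simp
  | cons G C ih =>
    rw [List.map_cons, List.prod_cons, ih, DiagonalGate.toMatrix, Matrix.diagonal_mul_diagonal]
    simp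

/-- Each Hadamard layer, evaluated at the zero string, contributes 2^(-n/2) for every z, and the
diagonal part contributes its phase at z. -/
theorem IQPCircuit.prob_eq {n : ℕ} (C : IQPCircuit n) :
    C.prob = ‖∑ z : Fin n → Bool, (C.map fun G => (G.phase z : ℂ)).prod‖ ^ 2 / 4 ^ n := by
  have h2 : (1 / (Real.sqrt 2 : ℂ)) * (1 / (Real.sqrt 2 : ℂ)) = 1 / 2 := by
    rw [div_mul_div_comm, ← Complex.ofReal_mul, Real.mul_self_sqrt (by norm_num)]
    norm_num
  have h : C.unitary (fun _ => false) (fun _ => false) =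
      (1 / 2) ^ n * ∑ z : Fin n → Bool, (C.map fun G => (G.phase z : ℂ)).prod := by
    rw [IQPCircuit.unitary, prod_toMatrix, Matrix.mul_apply, Finset.mul_sum]
    refine Finset.sum_congr rfl fun z _ => ?_
    rw [Matrix.mul_diagonal, hadamardAll_zero_left, hadamardAll_zero_right, ← h2, mul_pow]
    ring
  have h4 : ‖((1 / 2 : ℂ)) ^ n‖ ^ 2 = 1 / 4 ^ n := by
    rw [norm_pow, ← pow_mul, mul_comm n, pow_mul, ← one_div_pow]
    congr 1
    norm_num
  rw [IQPCircuit.prob, h, norm_mul, mul_pow, h4]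
  ring

theorem Gate.exists_gateName {n : ℕ} (g : Gate (Fin n)) (hg : g.Valid) :
    ∃ G : GateName n, G.symbols = (g.map Fin.val).symbols ∧
      ∀ z, (G.toGate.phase z : ℂ) = g.phase z := by
  rcases g with i | i | ⟨i, j⟩
  · refine ⟨.S i, rfl, fun z => ?_⟩
    cases h : z i <;>
      simp [GateName.toGate, DiagonalGate.phase, Gate.phase, h, Circle.coe_exp,
        Complex.exp_pi_div_two_mul_I]
  · refine ⟨.T i, rfl, fun z => ?_⟩
    cases h : z i <;>
      simp [GateName.toGate, DiagonalGate.phase, Gate.phase, h, Circle.coe_exp, omega]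
  · refine ⟨.CZ i j hg, rfl, fun z => ?_⟩
    cases h : z i <;> cases h' : z j <;>
      simp [GateName.toGate, DiagonalGate.phase, Gate.phase, h, h', Circle.coe_exp]

theorem Gate.exists_gateNames {n : ℕ} (l : List (Gate (Fin n))) (hl : ∀ g ∈ l, g.Valid) :
    ∃ D : List (GateName n), D.length = l.length ∧
      D.flatMap GateName.symbols = (l.map (Gate.map Fin.val)).flatMap Gate.symbols ∧
      ∀ z, ((D.map GateName.toGate).map fun G => (G.phase z : ℂ)).prod = phases l z := by
  induction l with
  | nil => exact ⟨[], rfl, rfl, fun z => rfl⟩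
  | cons g l ih =>
    obtain ⟨D, h1, h2, h3⟩ := ih fun g' hg' => hl g' (List.mem_cons_of_mem _ hg')
    obtain ⟨G, h4, h5⟩ := g.exists_gateName (hl g List.mem_cons_self)
    refine ⟨G :: D, by simp [h1], by simp [h2, h4], fun z => ?_⟩
    simp only [List.map_cons, List.prod_cons, phases_cons, h3, h5]

theorem Gate.exists_circuit {X : Type} [Fintype X] [DecidableEq X] {n : ℕ} (ι : X ≃ Fin n)
    (l : List (Gate X)) (hl : ∀ g ∈ l, g.Valid) :
    ∃ D : List (GateName n), D.length = l.length ∧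
      D.flatMap GateName.symbols =
        (l.map (Gate.map fun x => (ι x : ℕ))).flatMap Gate.symbols ∧
      IQPCircuit.prob (D.map GateName.toGate) = ‖∑ w : X → Bool, phases l w‖ ^ 2 / 4 ^ n := by
  obtain ⟨D, h1, h2, h3⟩ := Gate.exists_gateNames (l.map (Gate.map ι)) fun g hg => by
    obtain ⟨g', hg', rfl⟩ := List.mem_map.1 hg
    exact (hl g' hg').map ι.injective
  refine ⟨D, by simpa using h1, ?_, ?_⟩
  · rw [h2, List.map_map]
    congr 2
    funext g
    exact map_map _ _ g
  · rw [IQPCircuit.prob_eq]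
    simp only [h3, phases_map]
    rw [← (Equiv.arrowCongr ι (Equiv.refl Bool)).sum_comp]
    congr 4
    funext w
    congr 1
    funext x
    simp [Equiv.arrowCongr]

/-! ### Circuits which consist of cells -/

/-- The qubits: each of `M` cells has `b` visible and `a` auxiliary qubits. -/
abbrev CellVar (M b a : ℕ) : Type := Fin M × (Fin b ⊕ Fin a)

/-- The position of a qubit in its cell. -/
def cellOffset {b a : ℕ} : Fin b ⊕ Fin a → ℕ := Sum.elim (fun c => c) fun r => b + r

/-- The number of a qubit. -/
def cellIndex {M b a : ℕ} (v : CellVar M b a) : ℕ := (b + a) * v.1 + cellOffset v.2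

theorem exists_equiv_cellIndex (M b a : ℕ) :
    ∃ ι : CellVar M b a ≃ Fin ((b + a) * M), ∀ v, (ι v : ℕ) = cellIndex v := by
  refine ⟨((Equiv.refl _).prodCongr finSumFinEquiv).trans
    (finProdFinEquiv.trans (finCongr (Nat.mul_comm _ _))), fun ⟨j, v⟩ => ?_⟩
  rcases v with v | v <;> simp [cellIndex, cellOffset, add_comm]

/-- The contents of the visible qubits, extended by zero. -/
def visible {M b : ℕ} (u : Fin M → Fin b → Bool) (j : ℕ) : Fin b → Bool :=
  if h : j < M then u ⟨j, h⟩ else fun _ => false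

/-- The gates, which do not use auxiliary qubits of cells other than `j`, multiply the amplitude by
`W` and a factor of modulus at least `2`. -/
def ImplementsAt {M b a : ℕ} (l : List (Gate (CellVar M b a))) (j : Fin M)
    (W : (Fin M → Fin b → Bool) → ℂ) : Prop :=
  (∀ g ∈ l, g.Valid) ∧
    ∃ (Φ : (Fin M → Fin b → Bool) → (Fin a → Bool) → ℂ) (c : ℂ), 2 ≤ ‖c‖ ∧
      (∀ w, phases l w = Φ (fun i k => w (i, .inl k)) fun r => w (j, .inr r)) ∧
      ∀ u, ∑ y, Φ u y = c * W u

theorem ImplementsAt.of_list {M b a : ℕ} {V : Type} {l : List (Gate (V ⊕ Fin a))} {c : ℂ}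
    {W : (V → Bool) → ℂ} (hl : ∀ g ∈ l, g.Valid) (hc : 2 ≤ ‖c‖)
    (h : ∀ x, ∑ y : Fin a → Bool, phases l (Sum.elim x y) = c * W x) (j : Fin M)
    (v : V → Fin M × Fin b) (hv : Function.Injective v) :
    ImplementsAt (l.map (Gate.map (Sum.elim (fun i => ((v i).1, .inl (v i).2))
      fun r => ((j, .inr r) : CellVar M b a)))) j fun u => W fun i => u (v i).1 (v i).2 := by
  refine ⟨fun g hg => ?_, fun u y => phases l (Sum.elim (fun i => u (v i).1 (v i).2) y), c, hc,
    fun w => ?_, fun u => h _⟩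
  · obtain ⟨g', hg', rfl⟩ := List.mem_map.1 hg
    refine (hl g' hg').map ?_
    rintro (i | r) (i' | r') e
    · simp only [Sum.elim_inl, Prod.mk.injEq, Sum.inl.injEq] at e
      rw [hv (Prod.ext e.1 e.2)]
    · simp at e
    · simp at e
    · simp only [Sum.elim_inr, Prod.mk.injEq, Sum.inr.injEq] at e
      rw [e.2]
  · rw [phases_map]
    congr 1
    funext i
    cases i <;> rfl

theorem phases_blocks {X : Type} {f : ℕ → List (Gate ℕ)} {M : ℕ} {ι : X → ℕ}
    (l : Fin M → List (Gate X)) (hl : ∀ j, (l j).map (Gate.map ι) = f j) :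
    ∃ L : List (Gate X), L.map (Gate.map ι) = blocks f M ∧ (∀ g ∈ L, ∃ j, g ∈ l j) ∧
      ∀ w, phases L w = ∏ j, phases (l j) w := by
  induction M with
  | zero => exact ⟨[], rfl, by simp, by simp⟩
  | succ M ih =>
    obtain ⟨L, h1, h2, h3⟩ := ih (fun j => l j.castSucc) fun j => hl j.castSucc
    refine ⟨l (Fin.last M) ++ L, ?_, ?_, ?_⟩
    · rw [List.map_append, h1, hl, blocks]
      rfl
    · intro g hg
      rcases List.mem_append.1 hg with hg | hg
      · exact ⟨_, hg⟩
      · obtain ⟨j, hj⟩ := h2 g hg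
        exact ⟨_, hj⟩
    · intro w
      rw [phases_append, h3, Fin.prod_univ_castSucc, mul_comm]

/-- For fixed visible qubits, different factors involve disjoint sets of auxiliary qubits, so
distributivity exchanges sum and product. -/
theorem sum_prod_cells {M b a : ℕ} (Φ : Fin M → (Fin M → Fin b → Bool) → (Fin a → Bool) → ℂ) :
    ∑ w : CellVar M b a → Bool,
      ∏ j, Φ j (fun i k => w (i, .inl k)) (fun r => w (j, .inr r)) =
    ∑ u, ∏ j, ∑ y, Φ j u y := by
  let e : (CellVar M b a → Bool) ≃ (Fin M → Fin b → Bool) × (Fin M → Fin a → Bool) :=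
    { toFun := fun w => (fun i k => w (i, .inl k), fun i r => w (i, .inr r))
      invFun := fun p v => Sum.elim (p.1 v.1) (p.2 v.1) v.2
      left_inv := fun w => by
        funext ⟨i, v⟩
        cases v <;> rfl
      right_inv := fun p => rfl }
  rw [← e.symm.sum_comp, Fintype.sum_prod_type]
  refine Finset.sum_congr rfl fun u _ => ?_
  rw [Finset.prod_univ_sum, Fintype.piFinset_univ]
  rfl

/-- The constants of the cells multiply to one of modulus at least 2^M, hence at least 2 since there
is a cell. -/
theorem exists_circuit_of_cells {M b a : ℕ} (hM : 0 < M) {f : ℕ → List (Gate ℕ)}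
    {W : Fin M → (Fin M → Fin b → Bool) → ℂ}
    (h : ∀ j : Fin M, ∃ l : List (Gate (CellVar M b a)),
      l.map (Gate.map cellIndex) = f j ∧ ImplementsAt l j (W j)) :
    ∃ D : List (GateName ((b + a) * M)), D.length = (blocks f M).length ∧
      D.flatMap GateName.symbols = (blocks f M).flatMap Gate.symbols ∧
      ∃ c : ℂ, 2 ≤ ‖c‖ ∧ IQPCircuit.prob (D.map GateName.toGate) =
        ‖c * ∑ u, ∏ j, W j u‖ ^ 2 / 4 ^ ((b + a) * M) := by
  choose l hl hv Φ c hc hΦ hs using h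
  obtain ⟨ι, hι⟩ := exists_equiv_cellIndex M b a
  obtain ⟨L, h1, h2, h3⟩ := phases_blocks l hl
  obtain ⟨D, h4, h5, h6⟩ := Gate.exists_circuit ι L fun g hg => by
    obtain ⟨j, hj⟩ := h2 g hg
    exact hv j g hj
  refine ⟨D, ?_, ?_, ∏ j, c j, ?_, ?_⟩
  · rw [h4, ← h1, List.length_map]
  · rw [h5]
    simp only [hι]
    rw [← h1]
  · rw [norm_prod]
    calc (2 : ℝ) ≤ 2 ^ M := le_self_pow₀ (by norm_num) hM.ne'
      _ = ∏ _j : Fin M, (2 : ℝ) := by simp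
      _ ≤ ∏ j, ‖c j‖ := Finset.prod_le_prod (by simp) fun j _ => hc j
  · rw [h6]
    simp only [h3, hΦ]
    rw [sum_prod_cells]
    simp only [hs, Finset.prod_mul_distrib, ← Finset.mul_sum]

end

noncomputable section

/-! ### The weights of the cells -/

section Weight

variable {C : Type} {b : ℕ} (e : C → Fin b → Bool) (d : (Fin b → Bool) → C)
  (fn : C → C → C → C → C) (neg : C → Bool) (c₀ c₁ ce : C) (cx cy : Bool → C)

open Classical in
/-- The weight of cell `j`: it vanishes unless the contents of the cell are correct. -/
def cellWeight (x : List Bool) (P E : ℕ) : ℕ → (ℕ → Fin b → Bool) → ℂ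
  | 0, U => if U 0 = e c₀ then 1 else 0
  | 1, U => if U 1 = e c₁ then 1 else 0
  | i + 2, U =>
    if h : i < x.length then if U (i + 2) = e (cx x[i]) then 1 else 0
    else if i < x.length + P then
      if U (i + 2) = e (cy true) ∨ U (i + 2) = e (cy false) then 1 else 0
    else if i < x.length + P + E then if U (i + 2) = e ce then 1 else 0
    else
      (if U (i + 2) = e (fn (d (U (i - (x.length + P + E)))) (d (U (i - (x.length + P + E) + 1)))
        (d (U (i - (x.length + P + E) + 2))) (d (U (i + 1)))) then 1 else 0) *
      if neg (d (U (i + 2))) then -1 else 1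

variable {e d fn neg c₀ c₁ ce cx cy}

/-- A product of weights is nonzero only if every cell is correct, and then all contents are
determined by the freely chosen cells of y. So the surviving assignments are the encoded histories;
distinct y give distinct ones because `cy true ≠ cy false`. -/
theorem sum_prod_cellWeight {A : Set C} (hd : ∀ c ∈ A, d (e c) = c) (hcy : cy true ≠ cy false)
    {x : List Bool} {P E Q : ℕ} (hE : 2 ≤ E) {hist : (Fin P → Bool) → ℕ → C} (hA : ∀ y j, hist y j ∈ A)
    (h0 : ∀ y, hist y 0 = c₀) (h1 : ∀ y, hist y 1 = c₁)
    (hx : ∀ y (i : Fin x.length), hist y (i + 2) = cx (x.get i))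
    (hy : ∀ y (i : Fin P), hist y (x.length + i + 2) = cy (y i))
    (he : ∀ y, ∀ i < E, hist y (x.length + P + i + 2) = ce)
    (hs : ∀ y j, hist y (j + (x.length + P + E) + 2) = fn (hist y j) (hist y (j + 1))
      (hist y (j + 2)) (hist y (j + (x.length + P + E) + 1))) :
    ∑ u : Fin (x.length + P + E + Q + 2) → Fin b → Bool,
      ∏ j : Fin (x.length + P + E + Q + 2),
        cellWeight e d fn neg c₀ c₁ ce cx cy x P E j (visible u) =
    ∑ y : Fin P → Bool, ∏ j ∈ Finset.range Q,
      if neg (hist y (j + (x.length + P + E) + 2)) then (-1 : ℂ) else 1 := by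
  set m := x.length + P + E with hm
  set M := m + Q + 2 with hM
  have hvis : ∀ y, ∀ j < M, visible (fun i : Fin M => e (hist y i)) j = e (hist y j) := by
    intro y j hj
    simp [visible, hj]
  have hinj : ∀ {c c'}, c ∈ A → c' ∈ A → e c = e c' → c = c' := by
    intro c c' h h' hc
    rw [← hd c h, ← hd c' h', hc]
  refine (Fintype.sum_of_injective (fun y (j : Fin M) => e (hist y j)) ?_ _ _ ?_ ?_).symm
  · intro y y' h
    funext i
    have h2 := congrFun h ⟨x.length + i + 2, by have := i.2; omega⟩
    have h3 := hinj (hA _ _) (hA _ _) h2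
    simp only [hy] at h3
    cases hi : y i <;> cases hi' : y' i <;> simp_all
  · intro u hu
    by_contra hne
    replace hne := Finset.prod_ne_zero_iff.1 hne
    apply hu
    -- The guess y is read off from its cells; strong induction along the line of cells then shows
    -- that all others agree with its history.
    let y : Fin P → Bool := fun i =>
      if visible u (x.length + i + 2) = e (cy true) then true else false
    have key : ∀ j < M, visible u j = e (hist y j) := by
      intro j
      induction j using Nat.strong_induction_on with
      | _ j ih =>
      intro hj
      have hw := hne ⟨j, hj⟩ (Finset.mem_univ _)
      dsimp only at hw
      match j, ih, hj, hw with
      | 0, _, _, hw =>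
        rw [h0]
        by_contra hc
        simp [cellWeight, hc] at hw
      | 1, _, _, hw =>
        rw [h1]
        by_contra hc
        simp [cellWeight, hc] at hw
      | i + 2, ih, hj, hw =>
        rw [cellWeight] at hw
        by_cases hi1 : i < x.length
        · rw [dif_pos hi1] at hw
          rw [hx y ⟨i, hi1⟩]
          by_contra hc
          exact hw (if_neg hc)
        rw [dif_neg hi1] at hw
        by_cases hi2 : i < x.length + P
        · rw [if_pos hi2] at hw
          obtain ⟨k, rfl⟩ : ∃ k, i = x.length + k := ⟨i - x.length, by omega⟩
          rw [hy y ⟨k, by omega⟩]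
          simp only [y]
          split_ifs with h6
          · exact h6
          · by_contra hc
            exact hw (if_neg (not_or.2 ⟨h6, hc⟩))
        rw [if_neg hi2] at hw
        by_cases hi3 : i < x.length + P + E
        · rw [if_pos hi3] at hw
          obtain ⟨k, rfl⟩ : ∃ k, i = x.length + P + k := ⟨i - (x.length + P), by omega⟩
          rw [he y k (by omega)]
          by_contra hc
          exact hw (if_neg hc)
        rw [if_neg hi3] at hw
        obtain ⟨k, rfl⟩ : ∃ k, i = k + m := ⟨i - m, by omega⟩
        rw [← hm, Nat.add_sub_cancel, ih k (by omega) (by omega), ih (k + 1) (by omega) (by omega),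
          ih (k + 2) (by omega) (by omega), ih (k + m + 1) (by omega) (by omega),
          hd _ (hA _ _), hd _ (hA _ _), hd _ (hA _ _), hd _ (hA _ _), ← hs] at hw
        by_contra hc
        rw [if_neg hc, zero_mul] at hw
        exact hw rfl
    refine ⟨y, funext fun j => ?_⟩
    refine (key j j.2).symm.trans ?_
    simp [visible]
  · intro y
    have e1 : ∏ j : Fin M, cellWeight e d fn neg c₀ c₁ ce cx cy x P E j
        (visible fun i : Fin M => e (hist y i)) =
        ∏ j ∈ Finset.range (m + 2 + Q), cellWeight e d fn neg c₀ c₁ ce cx cy x P E j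
          (visible fun i : Fin M => e (hist y i)) := by
      rw [show m + 2 + Q = M by omega, Finset.prod_range]
    refine Eq.symm ?_
    rw [e1, Finset.prod_range_add, Finset.prod_eq_one, one_mul]
    · refine Finset.prod_congr rfl fun j hj => ?_
      have hj := Finset.mem_range.1 hj
      rw [show m + 2 + j = j + m + 2 by ring, cellWeight, dif_neg (by omega), if_neg (by omega),
        if_neg (by omega), ← hm, Nat.add_sub_cancel, hvis y _ (by omega), hvis y _ (by omega),
        hvis y _ (by omega), hvis y _ (by omega), hvis y _ (by omega), hd _ (hA _ _),
        hd _ (hA _ _), hd _ (hA _ _), hd _ (hA _ _), hd _ (hA _ _), ← hs, if_pos rfl, one_mul]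
    · intro j hj
      have hj := Finset.mem_range.1 hj
      match j, hj with
      | 0, hj => rw [cellWeight, hvis y _ (by omega), h0, if_pos rfl]
      | 1, hj => rw [cellWeight, hvis y _ (by omega), h1, if_pos rfl]
      | i + 2, hj =>
        rw [cellWeight, hvis y _ (by omega)]
        by_cases hi1 : i < x.length
        · rw [dif_pos hi1, hx y ⟨i, hi1⟩]
          exact if_pos rfl
        rw [dif_neg hi1]
        by_cases hi2 : i < x.length + P
        · obtain ⟨k, rfl⟩ : ∃ k, i = x.length + k := ⟨i - x.length, by omega⟩
          rw [if_pos hi2, hy y ⟨k, by omega⟩]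
          refine if_pos ?_
          cases y ⟨k, by omega⟩
          · exact .inr rfl
          · exact .inl rfl
        obtain ⟨k, rfl⟩ : ∃ k, i = x.length + P + k := ⟨i - (x.length + P), by omega⟩
        rw [if_neg hi2, if_pos (by omega), he y k (by omega), if_pos rfl]

end Weight

end

noncomputable section

open Gate

/-! ### The templates for the gates of a cell -/

/-- The truth value of `R` is computed into a hidden bit, to which `Z` = `S`² is applied. -/
theorem Realizable.sign {V : Type} [Finite V] (R : (V → Bool) → Prop) [DecidablePred R] :
    Realizable fun x => if R x then (-1 : ℂ) else 1 := by
  have h1 : Realizable fun x : V ⊕ Unit → Bool =>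
      if x (.inr ()) = decide (R (x ∘ Sum.inl)) then (1 : ℂ) else 0 :=
    indicator fun x : V ⊕ Unit → Bool => x (.inr ()) = decide (R (x ∘ Sum.inl))
  have h2 : Realizable (phases [S (.inr () : V ⊕ Unit), S (.inr ())]) :=
    of_gates _ (by simp [Valid])
  refine (h1.mul h2).hide.congr fun x => ?_
  rw [sum_unit]
  change (if true = decide (R x) then (1 : ℂ) else 0) * phases _ _ +
    (if false = decide (R x) then (1 : ℂ) else 0) * phases _ _ = _
  by_cases hR : R x <;> simp [hR, Gate.phase]

/-- The template for a cell with prescribed contents. -/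
def initialTemplate {b a : ℕ} (k : ℕ) (l : List (Gate (Fin b ⊕ Fin a))) :
    List (Gate (Bool × ℕ)) :=
  l.map (Gate.map fun v => (false, k + cellOffset v))

/-- One template must serve circuits of all sizes, so it is chosen before `M` and `j`. Every `a ≥
a₀` is allowed so that all kinds of cells can share the same `a`. The fixed offset `k` is needed
because the program's counter is 0 for the first two cells and thereafter lags two cells behind. -/
theorem exists_initialTemplate {b : ℕ} (R : (Fin b → Bool) → Prop) [DecidablePred R] :
    ∃ a₀ : ℕ, ∀ a ≥ a₀, ∀ k : ℕ, ∃ t : List (Gate (Bool × ℕ)), t.length ≤ a ∧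
      ∀ (M : ℕ) (j : Fin M) (J : ℕ), J + k = (b + a) * j →
        ∃ l : List (Gate (CellVar M b a)), l.map (Gate.map cellIndex) = instantiate J 0 t ∧
          ImplementsAt l j fun u => if R (u j) then 1 else 0 := by
  obtain ⟨a₀, h⟩ := (Realizable.indicator R).exists_list
  refine ⟨a₀, fun a ha k => ?_⟩
  obtain ⟨l, c, h1, h2, h3, h4⟩ := h a ha
  refine ⟨initialTemplate k l, by simpa [initialTemplate] using h1, fun M j J hJ => ?_⟩
  refine ⟨_, ?_, ImplementsAt.of_list h2 h3 h4 j (Prod.mk j) (Prod.mk_right_injective j)⟩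
  rw [initialTemplate, instantiate, List.map_map, List.map_map]
  congr 1
  funext g
  simp only [Function.comp_apply, map_map]
  congr 1
  funext v
  rcases v with v | v <;> simp [cellIndex, cellOffset, refIndex] <;> omega

/-- The references in the template for a cell whose contents are determined by those of four
cells. -/
def tileRef (b a : ℕ) : (Fin 5 × Fin b) ⊕ Fin a → Bool × ℕ :=
  Sum.elim (fun v => (![false, false, false, true, true] v.1,
    ![0, b + a, 2 * (b + a), b + a, 2 * (b + a)] v.1 + v.2)) fun r => (true, 2 * (b + a) + (b + r))

/-- A local rule links three consecutive cells with two consecutive cells further on, so two base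
indices, `(b + a) * k` and that plus `(b + a) * m`, suffice. The bound `2 ≤ m` makes the five cells
distinct, as the renaming of variables must be injective to keep `CZ` gates valid. -/
theorem exists_tileTemplate {b : ℕ}
    (R S : (Fin b → Bool) → (Fin b → Bool) → (Fin b → Bool) → (Fin b → Bool) → (Fin b → Bool) →
      Prop) [∀ u₀ u₁ u₂ u₃ u₄, Decidable (R u₀ u₁ u₂ u₃ u₄)]
    [∀ u₀ u₁ u₂ u₃ u₄, Decidable (S u₀ u₁ u₂ u₃ u₄)] :
    ∃ a₀ : ℕ, ∀ a ≥ a₀, ∃ t : List (Gate (Bool × ℕ)), t.length ≤ a ∧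
      ∀ (M : ℕ) (s : Fin 5 → Fin M) (k m : ℕ), 2 ≤ m → (s 0 : ℕ) = k → (s 1 : ℕ) = k + 1 →
        (s 2 : ℕ) = k + 2 → (s 3 : ℕ) = k + m + 1 → (s 4 : ℕ) = k + m + 2 →
        ∃ l : List (Gate (CellVar M b a)),
          l.map (Gate.map cellIndex) = instantiate ((b + a) * k) ((b + a) * m) t ∧
          ImplementsAt l (s 4) fun u =>
            (if R (u (s 0)) (u (s 1)) (u (s 2)) (u (s 3)) (u (s 4)) then 1 else 0) *
            if S (u (s 0)) (u (s 1)) (u (s 2)) (u (s 3)) (u (s 4)) then -1 else 1 := by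
  let v (i : Fin 5) (x : Fin 5 × Fin b → Bool) : Fin b → Bool := fun c => x (i, c)
  obtain ⟨a₀, h⟩ := ((Realizable.indicator fun x => R (v 0 x) (v 1 x) (v 2 x) (v 3 x) (v 4 x)).mul
    (Realizable.sign fun x => S (v 0 x) (v 1 x) (v 2 x) (v 3 x) (v 4 x))).exists_list
  refine ⟨a₀, fun a ha => ?_⟩
  obtain ⟨l, c, h1, h2, h3, h4⟩ := h a ha
  refine ⟨l.map (Gate.map (tileRef b a)), by simpa using h1,
    fun M s k m hm hs0 hs1 hs2 hs3 hs4 => ?_⟩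
  have hs : Function.Injective s := by
    intro i i' e
    have e := congrArg Fin.val e
    fin_cases i <;> fin_cases i' <;> simp at e ⊢ <;> omega
  refine ⟨_, ?_, ImplementsAt.of_list h2 h3 h4 (s 4) (Prod.map s id)
    (hs.prodMap Function.injective_id)⟩
  rw [instantiate, List.map_map, List.map_map]
  congr 1
  funext g
  simp only [Function.comp_apply, map_map]
  congr 1
  funext w
  rcases w with ⟨i, c⟩ | r
  · fin_cases i <;> simp [cellIndex, cellOffset, refIndex, tileRef, hs0, hs1, hs2, hs3, hs4] <;>
      ring
  · simp [cellIndex, cellOffset, refIndex, tileRef, hs4]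
    ring

theorem exists_templates {C : Type} {b : ℕ} (e : C → Fin b → Bool) (d : (Fin b → Bool) → C)
    (fn : C → C → C → C → C) (neg : C → Bool) (c₀ c₁ ce : C) (cx cy : Bool → C) :
    ∃ (a : ℕ) (t₀ t₁ ty te tt : List (Gate (Bool × ℕ))) (tx : Bool → List (Gate (Bool × ℕ))),
      ∀ (x : List Bool) (P E Q : ℕ), 2 ≤ E → ∀ j : Fin (x.length + P + E + Q + 2),
        (Prog.cellGates (b + a) t₀ t₁ ty te tt tx x P E j).length ≤ a ∧
        ∃ l : List (Gate (CellVar (x.length + P + E + Q + 2) b a)),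
          l.map (Gate.map cellIndex) = Prog.cellGates (b + a) t₀ t₁ ty te tt tx x P E j ∧
          ImplementsAt l j fun u =>
            cellWeight e d fn neg c₀ c₁ ce cx cy x P E j (visible u) := by
  classical
  obtain ⟨a₀, h₀⟩ := exists_initialTemplate fun u : Fin b → Bool => u = e c₀
  obtain ⟨a₁, h₁⟩ := exists_initialTemplate fun u : Fin b → Bool => u = e c₁
  obtain ⟨ay, hy⟩ := exists_initialTemplate fun u : Fin b → Bool =>
    u = e (cy true) ∨ u = e (cy false)
  obtain ⟨ae, he⟩ := exists_initialTemplate fun u : Fin b → Bool => u = e ce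
  obtain ⟨af, hf⟩ := exists_initialTemplate fun u : Fin b → Bool => u = e (cx false)
  obtain ⟨ax, hx⟩ := exists_initialTemplate fun u : Fin b → Bool => u = e (cx true)
  obtain ⟨at', ht⟩ := exists_tileTemplate
    (fun u₀ u₁ u₂ u₃ u₄ : Fin b → Bool => u₄ = e (fn (d u₀) (d u₁) (d u₂) (d u₃)))
    (fun u₀ u₁ u₂ u₃ u₄ : Fin b → Bool => neg (d u₄) = true)
  -- The sum exceeds all thresholds, so each cell has `a` auxiliary qubits and at most `a` gates.
  set a := a₀ + a₁ + ay + ae + af + ax + at' with ha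
  obtain ⟨t₀, l₀, h₀⟩ := h₀ a (by omega) 0
  obtain ⟨t₁, l₁, h₁⟩ := h₁ a (by omega) (b + a)
  obtain ⟨ty, ly, hy⟩ := hy a (by omega) (2 * (b + a))
  obtain ⟨te, le, he⟩ := he a (by omega) (2 * (b + a))
  obtain ⟨tf, lf, hf⟩ := hf a (by omega) (2 * (b + a))
  obtain ⟨tx, lx, hx⟩ := hx a (by omega) (2 * (b + a))
  obtain ⟨tt, lt, ht⟩ := ht a (by omega)
  refine ⟨a, t₀, t₁, ty, te, tt, fun c => if c then tx else tf, fun x P E Q hE j => ?_⟩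
  have hlen : ∀ J V t, t.length ≤ a → (instantiate J V t).length ≤ a := by
    intro J V t h
    simpa [instantiate] using h
  have hvis : ∀ (u : Fin (x.length + P + E + Q + 2) → Fin b → Bool) i hi,
      visible u i = u ⟨i, hi⟩ := by
    intro u i hi
    simp [visible, hi]
  obtain ⟨j, hj⟩ := j
  match j, hj with
  | 0, hj =>
    refine ⟨hlen _ _ _ l₀, ?_⟩
    simp only [cellWeight, hvis _ _ hj]
    exact h₀ _ ⟨0, hj⟩ _ (by simp)
  | 1, hj =>
    refine ⟨hlen _ _ _ l₁, ?_⟩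
    simp only [cellWeight, hvis _ _ hj]
    exact h₁ _ ⟨1, hj⟩ _ (by simp)
  | i + 2, hj =>
    simp only [cellWeight, Prog.cellGates]
    have hi : (b + a) * i + 2 * (b + a) = (b + a) * (i + 2) := by ring
    by_cases hi1 : i < x.length
    · simp only [hi1, dif_pos, hvis _ _ hj]
      cases x[i]
      · exact ⟨hlen _ _ _ lf, hf _ ⟨i + 2, hj⟩ _ hi⟩
      · exact ⟨hlen _ _ _ lx, hx _ ⟨i + 2, hj⟩ _ hi⟩
    simp only [dif_neg hi1]
    by_cases hi2 : i < x.length + P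
    · simp only [if_pos hi2, hvis _ _ hj]
      exact ⟨hlen _ _ _ ly, hy _ ⟨i + 2, hj⟩ _ hi⟩
    simp only [if_neg hi2]
    by_cases hi3 : i < x.length + P + E
    · simp only [if_pos hi3, hvis _ _ hj]
      exact ⟨hlen _ _ _ le, he _ ⟨i + 2, hj⟩ _ hi⟩
    simp only [if_neg hi3]
    refine ⟨hlen _ _ _ lt, ?_⟩
    set m := x.length + P + E with hm
    obtain ⟨k, rfl⟩ : ∃ k, i = k + m := ⟨i - m, by omega⟩
    rw [Nat.add_sub_cancel]
    simp only [hvis _ _ hj, hvis _ (k + m + 1) (by omega), hvis _ k (by omega),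
      hvis _ (k + 1) (by omega), hvis _ (k + 2) (by omega)]
    exact ht _ ![⟨k, by omega⟩, ⟨k + 1, by omega⟩, ⟨k + 2, by omega⟩, ⟨k + m + 1, by omega⟩,
      ⟨k + m + 2, hj⟩] k m (by omega) rfl rfl rfl rfl rfl

end

noncomputable section

/-! ### The reduction -/

theorem Gate.length_blocks_le {f : ℕ → List (Gate ℕ)} {a n : ℕ} (h : ∀ i < n, (f i).length ≤ a) :
    (blocks f n).length ≤ a * n := by
  induction n with
  | zero => simp [blocks]
  | succ n ih =>
    have h1 := h n (by omega)
    have h2 := ih fun i hi => h i (by omega)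
    rw [blocks, List.length_append, Nat.mul_succ]
    omega

instance : Fintype CircuitSymbol :=
  @Fintype.ofSurjective _ _ (Classical.decEq _) _
    ![CircuitSymbol.one, .mark, .S, .T, .CZ] fun c => by
    cases c
    exacts [⟨0, rfl⟩, ⟨1, rfl⟩, ⟨2, rfl⟩, ⟨3, rfl⟩, ⟨4, rfl⟩]

theorem Set.Finite.exists_binary_code {C : Type} {A : Set C} (hA : A.Finite) (c₀ : C) :
    ∃ (b : ℕ) (e : C → Fin b → Bool) (d : (Fin b → Bool) → C), ∀ c ∈ A, d (e c) = c := by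
  classical
  have : Nonempty C := ⟨c₀⟩
  have := hA.to_subtype
  obtain ⟨b, ⟨ι⟩⟩ := Finite.exists_equiv_fin A
  -- One-hot code: one bit for each element of `A`.
  let e : C → Fin b → Bool := fun c i => decide ((ι.symm i : C) = c)
  have he : Set.InjOn e A := by
    intro c hc c' _ h
    have := congrFun h (ι ⟨c, hc⟩)
    simpa [e] using this
  exact ⟨b, e, Function.invFunOn e A, fun c hc => he.leftInvOn_invFunOn hc⟩

/-- The number of qubits depends on |x| only, so the map that reads the answer can recompute it from
x. The bound on the number of gates places the circuit in the chosen family. -/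
theorem InCoCeqP.exists_reduction {L : Set (List Bool)} (hL : InCoCeqP L) :
    ∃ (g : List Bool → IQPDescription) (N : Polynomial ℕ),
      PolyTime (encodingList Bool) encodingIQP g ∧
      ∀ x, (g x).qubits = N.eval x.length ∧ (g x).gates.length ≤ (g x).qubits ∧
        ∃ S : ℝ, (S = 0 ∨ 2 ≤ S) ∧ IQPCircuit.prob (g x).circuit = S / 4 ^ (g x).qubits ∧
          (x ∈ L ↔ S ≠ 0) := by
  obtain ⟨C, A, fn, neg, c₀, c₁, ce, cx, cy, p, E, Q, hA, hcy, h⟩ := hL.exists_cells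
  obtain ⟨b, e, d, hd⟩ := hA.exists_binary_code c₀
  obtain ⟨a, t₀, t₁, ty, te, tt, tx, ht⟩ := exists_templates e d fn neg c₀ c₁ ce cx cy
  obtain ⟨prog, T, hT⟩ := Prog.exists_run_circuit (b + a) t₀ t₁ ty te tt tx p E Q
  let M (x : List Bool) : ℕ :=
    x.length + p.eval x.length + E.eval x.length + Q.eval x.length + 2
  let f (x : List Bool) : ℕ → List (Gate ℕ) :=
    Prog.cellGates (b + a) t₀ t₁ ty te tt tx x (p.eval x.length) (E.eval x.length)
  have key : ∀ x, ∃ D : List (GateName ((b + a) * M x)), D.length ≤ (b + a) * M x ∧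
      D.flatMap GateName.symbols = (Gate.blocks (f x) (M x)).flatMap Gate.symbols ∧
      ∃ S : ℝ, (S = 0 ∨ 2 ≤ S) ∧
        IQPCircuit.prob (D.map GateName.toGate) = S / 4 ^ ((b + a) * M x) ∧
        (x ∈ L ↔ S ≠ 0) := by
    intro x
    obtain ⟨hE, hist, h1, h2, h3, h4, h5, h6, h7, h8⟩ := h x
    have ht := ht x (p.eval x.length) (E.eval x.length) (Q.eval x.length) hE
    obtain ⟨D, hD1, hD2, c, hc, hD3⟩ := exists_circuit_of_cells (by omega) fun j => (ht j).2
    have hsum := sum_prod_cellWeight (fn := fn) (neg := neg) (c₀ := c₀) (c₁ := c₁) (ce := ce)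
      (cx := cx) (cy := cy) (Q := Q.eval x.length) hd hcy hE h1 h2 h3 h4 h5 h6 h7
    rw [hsum] at hD3
    set z : ℤ := ∑ y, ∏ j ∈ Finset.range (Q.eval x.length), (if neg (hist y (j +
      (x.length + p.eval x.length + E.eval x.length) + 2)) then (-1 : ℤ) else 1) with hz
    have hzc : (∑ y, ∏ j ∈ Finset.range (Q.eval x.length), (if neg (hist y (j +
      (x.length + p.eval x.length + E.eval x.length) + 2)) then (-1 : ℂ) else 1)) = (z : ℂ) := by
      rw [hz]
      push_cast
      rfl
    rw [hzc] at hD3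
    refine ⟨D, ?_, hD2, _, ?_, hD3, ?_⟩
    · rw [hD1]
      refine (Gate.length_blocks_le fun i hi => (ht ⟨i, hi⟩).1).trans ?_
      exact Nat.mul_le_mul_right _ (by omega)
    · rcases eq_or_ne z 0 with h0 | h0
      · left
        simp [h0]
      · right
        -- The sum of signs is an integer, so if it is nonzero its modulus is at least 1, and |c| ≥
        -- 2 makes the square at least 4.
        have hz1 : (1 : ℝ) ≤ ‖(z : ℂ)‖ := by
          rw [Complex.norm_intCast]
          exact_mod_cast Int.one_le_abs h0
        have hm : 2 ≤ ‖c * (z : ℂ)‖ := by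
          rw [norm_mul]
          nlinarith
        nlinarith
    · have hc0 : c ≠ 0 := by
        rintro rfl
        norm_num at hc
      rw [h8]
      simp [hc0]
  choose D hD1 hD2 hD3 using key
  refine ⟨fun x => ⟨(b + a) * M x, D x⟩, Polynomial.C (b + a) * (Polynomial.X + p + E + Q + 2),
    ?_, fun x => ⟨?_, hD1 x, hD3 x⟩⟩
  · refine Prog.polyTime prog T fun x => (hT x).of_eq ?_ le_rfl
    change _ = (⟨[], unarySymbols ((b + a) * M x) ++ (D x).flatMap GateName.symbols, _⟩ :
      Store Bool CircuitSymbol)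
    rw [hD2]
  · simp [M]

end

theorem mainTheorem8 :
    ∃ F : (n : ℕ) → Set (List (GateName n)),
      (∃ n₀ : ℕ, ∀ n ≥ n₀, (F n).Nonempty) ∧
      (∃ q : Polynomial ℕ, ∀ n : ℕ, ∀ C ∈ F n, C.length ≤ q.eval n) ∧
      IsCoCeqPHard encodingIQP encodingRat {D | D.gates ∈ F D.qubits} ApproximatesProb := by
  -- The family consists of all lists of at most n gates: a cell with b + a qubits carries at most
  -- `a` gates.
  refine ⟨fun n => {C | C.length ≤ n}, ⟨0, fun n _ => ⟨[], by simp⟩⟩,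
    ⟨Polynomial.X, fun n C hC => by simpa using hC⟩, fun L hL => ?_⟩
  obtain ⟨g, N, hg, h⟩ := hL.exists_reduction
  -- The threshold 4⁻ⁿ is 2⁻²ⁿ, hence the doubled polynomial.
  refine ⟨g, fun q => exceedsThreshold ((2 * N).eval q.1.length) q.2, hg,
    Prog.polyTime_exceedsThreshold _, fun x => ?_⟩
  obtain ⟨h1, h2, S, hS, h3, h4⟩ := h x
  refine ⟨h2, fun v hv => ?_⟩
  rw [ApproximatesProb, h3] at hv
  have e : (2 * N).eval x.length = 2 * (g x).qubits := by
    rw [h1, Polynomial.eval_mul]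
    simp
  simp only [e]
  rw [h4, exceedsThreshold_iff hS hv]
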